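/- **Setting.** Let $N_t\ge 1$ and $N_x>2$ be integers and let $N_\gamma\in\mathbb Z$ be coprime with $N_x$; put $\gamma=2\pi N_\gamma/N_x$. Consider the square lattice on the twisted torus: the nodes are $(t,x)$ with $0\le t<N_t$ and $x\in\mathbb Z/N_x$, with the identification $(N_t,x)\equiv(0,x+N_\gamma)$. From each node $(t,x)$ leave a horizontal link to $(t,x+1)$ and a vertical link to $(t+1,x)$, which carry spins $T_{t,x},L_{t,x}\in\tfrac12\mathbb N$ and group elements $h^{(h)}_{t,x},h^{(v)}_{t,x}\in\mathrm{SU}(2)$. With $|{\uparrow}\rangle=(1,0)$, $|+\rangle=(1,1)/\sqrt2$ and the normalized Haar measure $\mathrm dg$ on $\mathrm{SU}(2)$, let $$\psi^{T,L}_{LS}(h)=\int\prod_{t,x}\mathrm dg_{t,x}\,\langle\uparrow|g_{t,x+1}^{-1}h^{(h)}_{t,x}g_{t,x}|\uparrow\rangle^{2T_{t,x}}\,\langle+|g_{t+1,x}^{-1}h^{(v)}_{t,x}g_{t,x}|+\rangle^{2L_{t,x}} .$$ The coherent spin network wave-function with couplings $\lambda,\tau\in\mathbb C$ is $$\psi_{\lambda,\tau}(h)=\sum_{T,L}\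 \prod_{t,x}\frac{\lambda^{2L_{t,x}}\tau^{2T_{t,x}}}{(2L_{t,x})!\,(2T_{t,x})!}(J_{t,x}+1)!\ \psi^{T,L}_{LS}(h),\qquad J_{t,x}=T_{t,x}+L_{t,x}+T_{t,x-1}+L_{t-1,x},$$ with $(J+1)!=\Gamma(J+2)$, for small couplings, and for other couplings the analytic continuation of this sum in $(\lambda,\tau)$ to a connected open set of couplings. For $H\in\mathrm{SU}(2)$ let $h_H$ be the assignment with $h^{(h)}_{t,x}=\mathbb I$ for all $(t,x)$, $h^{(v)}_{t,x}=\mathbb I$ for $t<N_t-1$ and $h^{(v)}_{N_t-1,x}=H$. The Ponzano–Regge partition function of the twisted solid torus with this boundary state is $$Z_{N_\gamma}=\int_{\mathrm{SU}(2)}\mathrm dH\ \psi_{\lambda,\tau}(h_H).$$ **Proposition.** Let $\lambda,\tau\in\mathbb C$ satisfy $\lambda^2+\tau^2=1$, and assume that the couplings are non-degenerate: $\lambda\ne0$, $\lambda$ is not a real number with $|\lambda|\ge1$, and $\tau\cos(2\pi k/N_x)\ne1$ for all integers $k\ge0$. For $a\in\{\lambda^{-1},\tau^{-1}\}$ let $X_a=\operatorname{arcosh}(a)$,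 i.e. any complex number with $\operatorname{ch}X_a=a$ and $\operatorname{Re}X_a\ge0$. Then for every $H\in\mathrm{SU}(2)$ the sum defining $\psi_{\lambda,\tau}(h_H)$ converges for small couplings and has an analytic continuation to the given couplings, whose value there is unique; the function $H\mapsto\psi_{\lambda,\tau}(h_H)$ is integrable; and $$Z_{N_\gamma}=\frac{2^{N_t(N_x-2)-1}}{(\lambda\tau)^{N_tN_x}}\,\frac1{\operatorname{sh}^{2N_t}\!\left(\tfrac12N_xX_{\tau^{-1}}\right)}\,\frac{N_x}{\operatorname{sh}(N_tX_{\lambda^{-1}})}\prod_{k=1}^{N_x-1}\frac1{2\left(\operatorname{ch}(N_tX_{\lambda^{-1}})-\cos(k\gamma+iN_tX_{\lambda^{-1}})\right)}$$ $$\phantom{Z_{N_\gamma}}=\frac{2^{N_t(N_x-2)-1}}{(\lambda\tau)^{N_tN_x}}\,\frac1{\operatorname{sh}^{2N_t}\!\left(\tfrac12N_xX_{\tau^{-1}}\right)}\,\frac1{\operatorname{sh}(N_xN_tX_{\lambda^{-1}})} .$$ In particular the partition function does not depend on the twist: $Z_{N_\gamma'}=Z_{N_\gamma}$ for every integer $N_\gamma'$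 coprime with $N_x$. -/

import Mathlib

open MeasureTheory Topology

noncomputable section

namespace PonzanoRegge

/-! ### The group `SU(2)` and its normalized Haar measure -/

/-- The group `SU(2)` of unitary `2 × 2` complex matrices of determinant one. -/
abbrev SU2 : Type := Matrix.specialUnitaryGroup (Fin 2) ℂ

instance : IsTopologicalGroup SU2 where
  continuous_inv := by
    refine continuous_induced_rng.mpr ?_
    exact (continuous_subtype_val (p := fun A => A ∈ Matrix.specialUnitaryGroup (Fin 2) ℂ)).star

theorem SU2.norm_entry_le_one (A : SU2) (i j : Fin 2) :
    ‖(A : Matrix (Fin 2) (Fin 2) ℂ) i j‖ ≤ 1 :=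
  entry_norm_bound_of_unitary (Matrix.mem_specialUnitaryGroup_iff.mp A.2).1 i j

instance : CompactSpace SU2 := by
  refine isCompact_iff_compactSpace.mp ?_
  have hK : IsCompact (Set.univ.pi fun _ : Fin 2 => Set.univ.pi fun _ : Fin 2 =>
      Metric.closedBall (0 : ℂ) 1) :=
    isCompact_univ_pi fun _ => isCompact_univ_pi fun _ => isCompact_closedBall _ _
  refine hK.of_isClosed_subset ?_ ?_
  · have h : {A : Matrix (Fin 2) (Fin 2) ℂ | A ∈ Matrix.specialUnitaryGroup (Fin 2) ℂ}
        = {A | A * star A = 1} ∩ {A | A.det = 1} := by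
      ext A
      simp [Matrix.mem_specialUnitaryGroup_iff, Matrix.mem_unitaryGroup_iff]
    change IsClosed {A : Matrix (Fin 2) (Fin 2) ℂ | A ∈ Matrix.specialUnitaryGroup (Fin 2) ℂ}
    rw [h]
    exact (isClosed_eq (continuous_id.mul continuous_id.star) continuous_const).inter
      (isClosed_eq continuous_id.matrix_det continuous_const)
  · intro A hA i _ j _
    simpa using SU2.norm_entry_le_one ⟨A, hA⟩ i j

instance : MeasurableSpace SU2 := borel SU2

instance : BorelSpace SU2 := ⟨rfl⟩

/-- The Haar measure of `SU(2)`, normalized to total mass one. -/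
def haarSU2 : Measure SU2 := Measure.haarMeasure ⊤

instance : IsProbabilityMeasure haarSU2 :=
  ⟨by simpa [haarSU2] using
    Measure.haarMeasure_self (K₀ := (⊤ : TopologicalSpace.PositiveCompacts SU2))⟩

/-- The matrix element `⟨ξ| g |ξ⟩` of `g ∈ SU(2)` in the fundamental representation. -/
def matrixElement (ξ : Fin 2 → ℂ) (g : SU2) : ℂ :=
  star ξ ⬝ᵥ ((g : Matrix (Fin 2) (Fin 2) ℂ).mulVec ξ)

/-- The unit spinor `|↑⟩`. -/
def spinorUp : Fin 2 → ℂ := ![1, 0]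

/-- The unit spinor `|+⟩ = (|↑⟩ + |↓⟩) / √2`. -/
def spinorPlus : Fin 2 → ℂ := ![((Real.sqrt 2)⁻¹ : ℝ), ((Real.sqrt 2)⁻¹ : ℝ)]

/-! ### The square lattice on the twisted torus -/

/-- Nodes `(t, x)` of the square lattice: `t` labels the time slice, `x` the position in space. -/
abbrev Node (Nt Nx : ℕ) : Type := Fin Nt × ZMod Nx

section Lattice

variable {Nt Nx : ℕ} [NeZero Nt]

/-- Target `(t, x + 1)` of the horizontal link leaving `(t, x)`. -/
def right (n : Node Nt Nx) : Node Nt Nx := (n.1, n.2 + 1)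

/-- Source `(t, x - 1)` of the horizontal link entering `(t, x)`. -/
def left (n : Node Nt Nx) : Node Nt Nx := (n.1, n.2 - 1)

/-- Target `(t + 1, x)` of the vertical link leaving `(t, x)`, with `(Nt, x) ≡ (0, x + Nγ)`.
Addition in `Fin Nt` wraps around, so `t + 1 = 0` singles out the last time slice. -/
def next (Nγ : ℤ) (n : Node Nt Nx) : Node Nt Nx :=
  (n.1 + 1, if n.1 + 1 = 0 then n.2 + (Nγ : ZMod Nx) else n.2)

/-- Source `(t - 1, x)` of the vertical link entering `(t, x)`. -/
def prev (Nγ : ℤ) (n : Node Nt Nx) : Node Nt Nx :=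
  (n.1 - 1, if n.1 = 0 then n.2 - (Nγ : ZMod Nx) else n.2)

theorem next_prev (Nγ : ℤ) (n : Node Nt Nx) : next Nγ (prev Nγ n) = n := by
  obtain ⟨t, x⟩ := n
  by_cases h : t = 0 <;> simp [next, prev, h]

theorem prev_next (Nγ : ℤ) (n : Node Nt Nx) : prev Nγ (next Nγ n) = n := by
  obtain ⟨t, x⟩ := n
  by_cases h : t + 1 = 0 <;> simp [next, prev, h]
  exact (eq_neg_of_add_eq_zero_left h).symm

end Lattice

/-! ### Coherent spin networks on the lattice -/

section States

variable (Nt Nx : ℕ) [NeZero Nt] [NeZero Nx] (Nγ : ℤ)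

/-- The Livine-Speziale spin network wave-function of the lattice with rectangular coherent
intertwiners, as a function of the group elements `hh n`, `hv n` on the horizontal and vertical
links leaving the node `n`. Spins are half-integers: `T n` and `L n` are *twice* the spins carried
by these two links. -/
def lsState (T L : Node Nt Nx → ℕ) (hh hv : Node Nt Nx → SU2) : ℂ :=
  ∫ g : Node Nt Nx → SU2,
    ∏ n, matrixElement spinorUp ((g (right n))⁻¹ * hh n * g n) ^ T n *
      matrixElement spinorPlus ((g (next Nγ n))⁻¹ * hv n * g n) ^ L n
    ∂(Measure.pi fun _ => haarSU2)

/-- The sum `J` of the spins of the four links meeting at the node `n` (again `T`, `L` are twice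
the spins). -/
def nodeSpin (T L : Node Nt Nx → ℕ) (n : Node Nt Nx) : ℝ :=
  ((T n : ℝ) + L n + T (left n) + L (prev Nγ n)) / 2

/-- The term of the coherent superposition of spin networks which belongs to given spins, for
homogeneous couplings: `q.1 = λ` on the vertical links and `q.2 = τ` on the horizontal links.
The node weight `(J + 1)!` is `Γ(J + 2)`. -/
def coherentTerm (hh hv : Node Nt Nx → SU2) (q : ℂ × ℂ)
    (S : (Node Nt Nx → ℕ) × (Node Nt Nx → ℕ)) : ℂ :=
  (∏ n, q.1 ^ S.2 n * q.2 ^ S.1 n / (((S.2 n).factorial : ℂ) * ((S.1 n).factorial : ℂ)) *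
      ((Real.Gamma (nodeSpin Nt Nx Nγ S.1 S.2 n + 2) : ℝ) : ℂ)) *
    lsState Nt Nx Nγ S.1 S.2 hh hv

/-- `z` is a value at the couplings `q` of the coherent spin network wave-function evaluated on
`hh`, `hv`: the sum over all spins converges for small couplings, and its sum continues
analytically, over a connected open set of couplings, to a function with value `z` at `q`. -/
def IsCoherentStateValue (hh hv : Node Nt Nx → SU2) (q : ℂ × ℂ) (z : ℂ) : Prop :=
  ∃ (U : Set (ℂ × ℂ)) (F : ℂ × ℂ → ℂ), IsOpen U ∧ IsConnected U ∧ (0, 0) ∈ U ∧ q ∈ U ∧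
    AnalyticOnNhd ℂ F U ∧
    (∀ᶠ p in 𝓝 ((0, 0) : ℂ × ℂ), HasSum (coherentTerm Nt Nx Nγ hh hv p) (F p)) ∧
    F q = z

/-- The coherent spin network wave-function with homogeneous couplings `q = (λ, τ)`. -/
def coherentState (q : ℂ × ℂ) (hh hv : Node Nt Nx → SU2) : ℂ :=
  Classical.epsilon fun z => IsCoherentStateValue Nt Nx Nγ hh hv q z

/-- The vertical group elements `hv = H` on the last time slice and `hv = 1` on all others. -/
def lastSlice (H : SU2) (n : Node Nt Nx) : SU2 := if n.1 + 1 = 0 then H else 1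

/-- The Ponzano-Regge amplitude of the twisted solid torus with coherent boundary state: the
integral, over the holonomy `H` along the non-contractible cycle, of the boundary wave-function
evaluated on the flat connection with holonomy `H`. -/
def partitionFunction (lam tau : ℂ) : ℂ :=
  ∫ H : SU2, coherentState Nt Nx Nγ (lam, tau) (fun _ => 1) (lastSlice Nt Nx H) ∂haarSU2

end States

/-- `X = arcosh a`: a complex number with `ch X = a` and `Re X ≥ 0`. -/
def IsArcosh (X a : ℂ) : Prop := Complex.cosh X = a ∧ 0 ≤ X.re

end PonzanoRegge

end

/-!
The twisted torus is evaluated by turning the sum over spins into a Gaussian integral.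

*From spins to a determinant.* In polar coordinates a quaternion is a positive radius times an
element of `SU(2)`, and integrating over it with weight `exp (-r²) r ^ (2J)` produces, up to a factor
`π²`, the weight `(J + 1)!` of a node at which `2J` spinor legs meet (`map_dir_radial`,
`prod_Gamma_mul_lsState`). The sums over `T` and `L` become exponential series, and for small
couplings dominated convergence gives the integral of `exp (-(|w|² - action))` over one quaternion
`w n` for each node (`hasSum_coherentTerm`). When the holonomy is diagonal the exponent is a
sesquilinear form in the two complex components of the quaternions, so the integral is the inverse
of the determinant of `kernelMat` (`hasSum_coherentTerm_diag`). By gauge invariance only the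
conjugacy class of `H` matters (`lsState_conj`), and every `H` is conjugate to a diagonal element
`diag (exp (i φ), exp (-i φ))`.

*Analytic continuation.* The kernel is affine in the couplings, so its determinant `D` is a
polynomial. The complement of its zero set is connected and carries the continuation `1 / D`, and
any other continuation `F` satisfies `F D = 1` by the identity theorem (`isCoherentStateValue_iff`).

*The determinant.* With `S` the translation in space and `V` the one in time (twisted by the phases
of the holonomy), the blocks of the kernel commute. For `λ² + τ² = 1` the block determinant
factorizes into `1 - τ (S + S⁻¹) / 2` and `1 - λ (V + V⁻¹) / 2` (`det_kernelMat`). Writing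
`τ = 1 / ch X`, each factor splits further into terms `1 - exp (-X) S`, and similarly for `λ`.
Here `S` consists of `Nt` cycles of length `Nx`, whereas `V` is a single cycle through all nodes,
because `Nγ` is coprime with `Nx`; the determinant of `1` minus a weighted cycle is `1` minus the
product of the weights. This is the step in which the twist disappears: the wave-function at `H`
is a constant times `1 / (ch Y - cos (Nx φ))` with `Y = Nx Nt Xλ` (`isCoherentStateValue_lastSlice`).

*The integral over the holonomy.* Half the trace of a Haar distributed element of `SU(2)` has the
moments of the semicircle law, so `cos (m φ)` averages to zero for `m ≥ 3`. Hence only the constant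
term of the Fourier expansion of the Poisson kernel `sh Y / (ch Y - cos (Nx φ))` survives, which is
where `Nx > 2` enters (`integral_cosh_sub_cos_angle`), and `Z` is the same constant divided by
`sh Y`. The product form follows from `xᴺ - yᴺ = ∏ (x - ωᵏ y)` and `∏ (1 - ωᵏ) = N` for a primitive
`N`-th root of unity `ω` (`sinh_mul_prod_cosh_sub_cos`).
-/

noncomputable section

namespace PonzanoRegge

open ComplexConjugate

/-! ### Complex Gaussian integrals -/

/-- The Gaussian integral over `ℂ` with independent sources for `z` and its conjugate. -/
theorem integral_complex_gaussian {k : ℂ} (hk : 0 < k.re) (a b : ℂ) :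
    ∫ z : ℂ, Complex.exp (-(k * (conj z * z)) + conj z * a + b * z) =
      Real.pi / k * Complex.exp (a * b / k) := by
  have hk0 : k ≠ 0 := fun h => by simp [h] at hk
  have hπ : (Real.pi : ℂ) ≠ 0 := by exact_mod_cast Real.pi_ne_zero
  rw [← Complex.volume_preserving_equiv_real_prod.symm.integral_comp
    Complex.measurableEquivRealProd.symm.measurableEmbedding]
  have key : ∀ p : ℝ × ℝ, Complex.exp (-(k * (conj (Complex.measurableEquivRealProd.symm p) *
      Complex.measurableEquivRealProd.symm p)) +
      conj (Complex.measurableEquivRealProd.symm p) * a +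
        b * Complex.measurableEquivRealProd.symm p) =
      Complex.exp (-k * (p.1 : ℂ) ^ 2 + (a + b) * p.1 + 0) *
      Complex.exp (-k * (p.2 : ℂ) ^ 2 + (Complex.I * (b - a)) * p.2 + 0) := by
    intro p
    have : Complex.measurableEquivRealProd.symm p = p.1 + p.2 * Complex.I := by
      apply Complex.ext <;> simp [Complex.measurableEquivRealProd_symm_apply]
    rw [← Complex.exp_add, this]
    congr 1
    simp only [map_add, map_mul, Complex.conj_ofReal, Complex.conj_I]
    linear_combination (k * p.2 ^ 2) * Complex.I_sq
  simp_rw [key]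
  rw [Measure.volume_eq_prod, integral_prod_mul
    (fun x : ℝ => Complex.exp (-k * (x : ℂ) ^ 2 + (a + b) * x + 0))
    (fun x : ℝ => Complex.exp (-k * (x : ℂ) ^ 2 + (Complex.I * (b - a)) * x + 0))]
  have hk' : (-k).re < 0 := by simpa using hk
  rw [integral_cexp_quadratic hk', integral_cexp_quadratic hk', neg_neg]
  have h2 : ((Real.pi : ℂ) / k) ^ (1 / 2 : ℂ) * ((Real.pi : ℂ) / k) ^ (1 / 2 : ℂ) =
      Real.pi / k := by
    rw [← Complex.cpow_add _ _ (div_ne_zero hπ hk0)]; norm_num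
  rw [mul_mul_mul_comm, h2, ← Complex.exp_add]
  congr 2
  field_simp
  linear_combination ((b - a) ^ 2) * Complex.I_sq

open Matrix in
/-- The Gaussian integral of a matrix with coercive real part, by induction on the dimension:
integration over the first coordinate replaces `K` by its Schur complement, which is coercive with
the same constant. -/
theorem integral_gaussian_matrix_fin (n : ℕ) : ∀ (K : Matrix (Fin n) (Fin n) ℂ) {c : ℝ}, 0 < c →
    (∀ w : Fin n → ℂ, c * ∑ i, ‖w i‖ ^ 2 ≤ (star w ⬝ᵥ K *ᵥ w).re) →
    (∫ w : Fin n → ℂ, Complex.exp (-(star w ⬝ᵥ K *ᵥ w))) * K.det = Real.pi ^ n := by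
  induction n with
  | zero =>
    intro K c _ _
    simp [measureReal_def, volume_pi]
  | succ n ih =>
    intro K c hc hK
    set k := K 0 0 with hk
    set r : Fin n → ℂ := fun j => K 0 j.succ with hr
    set l : Fin n → ℂ := fun j => K j.succ 0 with hl
    set K' : Matrix (Fin n) (Fin n) ℂ := K.submatrix Fin.succ Fin.succ with hK'
    have form : ∀ (z : ℂ) (w : Fin n → ℂ), star (Fin.cons z w : Fin (n+1) → ℂ) ⬝ᵥ
        K *ᵥ (Fin.cons z w) = k * (conj z * z) + conj z * (r ⬝ᵥ w) + (star w ⬝ᵥ l) * z +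
          star w ⬝ᵥ K' *ᵥ w := by
      intro z w
      simp only [dotProduct, mulVec, Fin.sum_univ_succ, Pi.star_apply, Fin.cons_zero, Fin.cons_succ,
        mul_add, Finset.sum_add_distrib, Finset.sum_mul, hk, hr, hl, hK', submatrix_apply,
        RCLike.star_def]
      have : ∑ x : Fin n, conj (w x) * (K x.succ 0 * z) = ∑ x, conj (w x) * K x.succ 0 * z :=
        Finset.sum_congr rfl fun _ _ => by ring
      rw [this]
      ring
    have nrm : ∀ (z : ℂ) (w : Fin n → ℂ), ∑ i, ‖(Fin.cons z w : Fin (n+1) → ℂ) i‖ ^ 2 =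
        ‖z‖ ^ 2 + ∑ i, ‖w i‖ ^ 2 := by
      intro z w; simp [Fin.sum_univ_succ]
    have hkre : 0 < k.re := by
      have := hK (Fin.cons 1 0)
      rw [form, nrm] at this
      simp at this
      linarith
    have hk0 : k ≠ 0 := fun h => by simp [h] at hkre
    set M : Matrix (Fin n) (Fin n) ℂ := K' - k⁻¹ • vecMulVec l r with hM
    have formM : ∀ w : Fin n → ℂ, star w ⬝ᵥ M *ᵥ w =
        star w ⬝ᵥ K' *ᵥ w - (star w ⬝ᵥ l) * (r ⬝ᵥ w) / k := by
      intro w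
      rw [hM, sub_mulVec, dotProduct_sub, smul_mulVec, dotProduct_smul, vecMulVec_mulVec]
      simp only [smul_eq_mul, dotProduct_smul, op_smul_eq_smul]
      ring
    have hMc : ∀ w : Fin n → ℂ, c * ∑ i, ‖w i‖ ^ 2 ≤ (star w ⬝ᵥ M *ᵥ w).re := by
      intro w
      -- the form of `M` is the form of `K` at its stationary point in the first coordinate
      have := hK (Fin.cons (-(r ⬝ᵥ w) / k) w)
      rw [form, nrm] at this
      have e : k * (conj (-(r ⬝ᵥ w) / k) * (-(r ⬝ᵥ w) / k)) + conj (-(r ⬝ᵥ w) / k) * (r ⬝ᵥ w) +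
          (star w ⬝ᵥ l) * (-(r ⬝ᵥ w) / k) + star w ⬝ᵥ K' *ᵥ w = star w ⬝ᵥ M *ᵥ w := by
        rw [formM]
        field_simp
        ring
      rw [e] at this
      refine le_trans ?_ this
      have := sq_nonneg ‖-(r ⬝ᵥ w) / k‖
      nlinarith
    -- clearing the first column of `K` by row operations
    have hdet : K.det = k * M.det := by
      have hB := det_eq_of_forall_row_eq_smul_add_const
        (A := K) (B := Matrix.of (Fin.cons (K 0) fun i => Fin.cons 0 (M i)))
        (Fin.cons 0 fun i => l i / k) 0 rfl (by
          intro i j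
          refine Fin.cases ?_ (fun i => ?_) i
          · simp
          · refine Fin.cases ?_ (fun j => ?_) j
            · simp [hl, ← hk, hk0]
            · simp [hM, hK', vecMulVec_apply, hr]
              ring)
      rw [hB, det_succ_column_zero, Fin.sum_univ_succ]
      simp [← hk]
      left
      rfl
    have hint : Integrable (fun p : ℂ × (Fin n → ℂ) =>
        Complex.exp (-(star (Fin.cons p.1 p.2 : Fin (n+1) → ℂ) ⬝ᵥ
        K *ᵥ (Fin.cons p.1 p.2)))) := by
      have hb : Integrable (fun z : ℂ => Real.exp (-c * ‖z‖ ^ 2)) := by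
        have := (GaussianFourier.integrable_cexp_neg_mul_sq_norm_add (V := ℂ) (b := c)
          (by simpa using hc) 0 0).norm
        refine this.congr (Filter.Eventually.of_forall fun z => ?_)
        simp [Complex.norm_exp, ← Complex.ofReal_pow]
      have hb' : Integrable (fun w : Fin n → ℂ => ∏ i, Real.exp (-c * ‖w i‖ ^ 2)) :=
        Integrable.fintype_prod (f := fun _ z => Real.exp (-c * ‖z‖ ^ 2)) fun _ => hb
      refine (hb.mul_prod hb').mono' ?_ ?_
      · refine Continuous.aestronglyMeasurable ?_
        simp only [form]
        fun_prop
      · refine Filter.Eventually.of_forall fun p => ?_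
        rw [Complex.norm_exp, ← Real.exp_sum, ← Real.exp_add]
        refine Real.exp_le_exp.mpr ?_
        have := hK (Fin.cons p.1 p.2)
        rw [nrm] at this
        rw [Complex.neg_re, ← Finset.mul_sum]
        linarith
    rw [hdet, ← (volume_preserving_piFinSuccAbove (fun _ => ℂ) 0).symm.integral_comp
      (MeasurableEquiv.measurableEmbedding _)]
    have e1 : ∀ p : ℂ × (Fin n → ℂ), (MeasurableEquiv.piFinSuccAbove (fun _ => ℂ) 0).symm p =
      (Fin.cons p.1 p.2 : Fin (n+1) → ℂ) := by
      intro p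
      simp [MeasurableEquiv.piFinSuccAbove, Fin.insertNthEquiv]
    simp_rw [e1]
    rw [Measure.volume_eq_prod, integral_prod_symm _ hint]
    have inner : ∀ w : Fin n → ℂ, ∫ z : ℂ, Complex.exp (-(star (Fin.cons z w : Fin (n+1) → ℂ) ⬝ᵥ
        K *ᵥ (Fin.cons z w))) = Real.pi / k * Complex.exp (-(star w ⬝ᵥ M *ᵥ w)) := by
      intro w
      have := integral_complex_gaussian hkre (-(r ⬝ᵥ w)) (-(star w ⬝ᵥ l))
      have e2 : ∀ z : ℂ, Complex.exp (-(star (Fin.cons z w : Fin (n+1) → ℂ) ⬝ᵥ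
          K *ᵥ (Fin.cons z w))) =
          Complex.exp (-(k * (conj z * z)) + conj z * (-(r ⬝ᵥ w)) + (-(star w ⬝ᵥ l)) * z) *
            Complex.exp (-(star w ⬝ᵥ K' *ᵥ w)) := by
        intro z
        rw [form, ← Complex.exp_add]
        congr 1; ring
      simp_rw [e2]
      rw [integral_mul_const, this, mul_assoc, ← Complex.exp_add, formM]
      congr 2; ring
    simp_rw [inner]
    rw [integral_const_mul]
    have := ih M hc hMc
    rw [pow_succ, ← this]
    field_simp

open Matrix in
/-- `∫ exp (-w* K w) = π ^ n / det K` for a complex matrix `K`, not necessarily Hermitian, whose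
real part is positive definite. -/
theorem integral_gaussian_matrix {ι : Type*} [Fintype ι] [DecidableEq ι] (K : Matrix ι ι ℂ) {c : ℝ}
    (hc : 0 < c) (hK : ∀ w : ι → ℂ, c * ∑ i, ‖w i‖ ^ 2 ≤ (star w ⬝ᵥ K *ᵥ w).re) :
    (∫ w : ι → ℂ, Complex.exp (-(star w ⬝ᵥ K *ᵥ w))) * K.det = Real.pi ^ Fintype.card ι := by
  set e := (Fintype.equivFin ι).symm
  have form : ∀ w : Fin (Fintype.card ι) → ℂ, star (w ∘ e.symm) ⬝ᵥ K *ᵥ (w ∘ e.symm) =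
      star w ⬝ᵥ (K.submatrix e e) *ᵥ w := by
    intro w
    simp only [dotProduct, mulVec, Function.comp, Pi.star_apply, submatrix_apply]
    rw [← e.sum_comp]
    refine Finset.sum_congr rfl fun i _ => ?_
    rw [← e.sum_comp]
    simp
  have := integral_gaussian_matrix_fin _ (K.submatrix e e) hc (by
    intro w
    have := hK (w ∘ e.symm)
    rw [form, ← e.sum_comp] at this
    simpa using this)
  rw [det_submatrix_equiv_self] at this
  rw [← this, ← (volume_measurePreserving_piCongrLeft (fun _ => ℂ) e).integral_comp
    (MeasurableEquiv.measurableEmbedding _)]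
  congr 2
  ext w
  have : MeasurableEquiv.piCongrLeft (fun _ => ℂ) e w = w ∘ e.symm := by
    ext i
    obtain ⟨j, rfl⟩ := e.surjective i
    simp [MeasurableEquiv.coe_piCongrLeft, Equiv.piCongrLeft_apply_apply]
  rw [this, form]

/-! ### Multiple series -/

theorem hasSum_prod_pi_fin {𝕜 : Type*} [RCLike 𝕜] (n : ℕ) : ∀ {f : Fin n → ℕ → 𝕜},
    (∀ i, Summable fun k => ‖f i k‖) →
    (Summable fun T : Fin n → ℕ => ‖∏ i, f i (T i)‖) ∧
      HasSum (fun T : Fin n → ℕ => ∏ i, f i (T i)) (∏ i, ∑' k, f i k) := by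
  induction n with
  | zero =>
    intro f _
    refine ⟨(hasSum_unique _).summable, ?_⟩
    simp
  | succ n ih =>
    intro f hf
    obtain ⟨h1, h2⟩ := ih (f := fun i => f i.succ) fun i => hf i.succ
    set G : (Fin n → ℕ) → 𝕜 := fun T => ∏ i : Fin n, f i.succ (T i) with hG
    have hm : Summable fun p : ℕ × (Fin n → ℕ) => f 0 p.1 * G p.2 :=
      summable_mul_of_summable_norm (f := f 0) (g := G) (hf 0) h1
    have h0 : HasSum (f 0) (∑' k, f 0 k) := (hf 0).of_norm.hasSum
    have hs : HasSum (fun p : ℕ × (Fin n → ℕ) => f 0 p.1 * G p.2)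
        ((∑' k, f 0 k) * ∏ i : Fin n, ∑' k, f i.succ k) :=
      HasSum.mul (f := f 0) (g := G) h0 h2 hm
    have hs' : Summable fun p : ℕ × (Fin n → ℕ) => ‖f 0 p.1 * G p.2‖ := by
      simp_rw [norm_mul]
      exact Summable.mul_of_nonneg (f := fun k => ‖f 0 k‖) (g := fun T => ‖G T‖) (hf 0) h1
        (fun _ => norm_nonneg _) fun _ => norm_nonneg _
    rw [Fin.prod_univ_succ]
    constructor
    · rw [← (Fin.consEquiv fun _ => ℕ).summable_iff]
      refine hs'.congr fun p => ?_
      simp [Fin.prod_univ_succ, Fin.consEquiv, hG]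
    · rw [← (Fin.consEquiv fun _ => ℕ).hasSum_iff]
      convert hs using 1
      ext p
      simp [Fin.prod_univ_succ, Fin.consEquiv, hG]

/-- A finite product of absolutely convergent series is the absolutely convergent sum over all
multi-indices. -/
theorem hasSum_prod_pi {𝕜 : Type*} [RCLike 𝕜] {ι : Type*} [Fintype ι] {f : ι → ℕ → 𝕜}
    (hf : ∀ i, Summable fun k => ‖f i k‖) :
    (Summable fun T : ι → ℕ => ‖∏ i, f i (T i)‖) ∧
      HasSum (fun T : ι → ℕ => ∏ i, f i (T i)) (∏ i, ∑' k, f i k) := by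
  set e := (Fintype.equivFin ι).symm
  obtain ⟨h1, h2⟩ := hasSum_prod_pi_fin _ (f := fun i => f (e i)) fun i => hf _
  have key : ∀ T : Fin (Fintype.card ι) → ℕ,
      ∏ i, f i (e.arrowCongr (Equiv.refl ℕ) T i) = ∏ i, f (e i) (T i) := by
    intro T
    rw [← e.prod_comp]
    simp
  constructor
  · rw [← (e.arrowCongr (Equiv.refl ℕ)).summable_iff]
    exact h1.congr fun T => by simp only [Function.comp, key]
  · rw [← (e.arrowCongr (Equiv.refl ℕ)).hasSum_iff, ← e.prod_comp]
    convert h2 using 1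
    ext T
    simp only [Function.comp, key]

/-- Multivariate exponential series, over pairs of multi-indices. -/
theorem hasSum_exp_pi_prod {𝕜 : Type*} [RCLike 𝕜] {ι : Type*} [Fintype ι] (a b : ι → 𝕜) :
    HasSum (fun S : (ι → ℕ) × (ι → ℕ) =>
      (∏ i, a i ^ S.1 i / ((S.1 i).factorial : 𝕜)) * ∏ i, b i ^ S.2 i / ((S.2 i).factorial : 𝕜))
      ((∏ i, NormedSpace.exp (a i)) * ∏ i, NormedSpace.exp (b i)) := by
  have hs : ∀ a : ι → 𝕜, ∀ i, Summable fun k : ℕ => ‖a i ^ k / (k.factorial : 𝕜)‖ :=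
    fun a i => NormedSpace.norm_expSeries_div_summable (a i)
  have he : ∀ a : ι → 𝕜, ∏ i, ∑' k : ℕ, a i ^ k / (k.factorial : 𝕜) =
      ∏ i, NormedSpace.exp (a i) := by
    intro a
    exact Finset.prod_congr rfl fun i _ => (congrFun NormedSpace.exp_eq_tsum_div (a i)).symm
  obtain ⟨h1, h2⟩ := hasSum_prod_pi (hs a)
  obtain ⟨h3, h4⟩ := hasSum_prod_pi (hs b)
  rw [← he a, ← he b]
  set F : (ι → ℕ) → 𝕜 := fun T => ∏ i, a i ^ T i / ((T i).factorial : 𝕜) with hF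
  set G : (ι → ℕ) → 𝕜 := fun T => ∏ i, b i ^ T i / ((T i).factorial : 𝕜) with hG
  exact HasSum.mul (f := F) (g := G) h2 h4 (summable_mul_of_summable_norm (f := F) (g := G) h1 h3)

/-! ### Determinants of block matrices and of weighted permutations -/

open Matrix Polynomial in
/-- The determinant of a block matrix whose lower blocks commute. The lower right block is made
invertible by adding a formal multiple of the identity to it. -/
theorem det_fromBlocks_of_commute {ι : Type*} [Fintype ι] [DecidableEq ι]
    (A B C D : Matrix ι ι ℂ) (hCD : C * D = D * C) :
    (fromBlocks A B C D).det = (A * D - B * C).det := by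
  let f : ℂ →+* ℂ[X] := Polynomial.C
  set D' : Matrix ι ι ℂ[X] := f.mapMatrix D + (X : ℂ[X]) • (1 : Matrix ι ι ℂ[X]) with hD'
  have hC : f.mapMatrix C * D' = D' * f.mapMatrix C := by
    rw [hD', mul_add, add_mul, ← map_mul, hCD, map_mul]; simp
  have h1 : fromBlocks (f.mapMatrix A) (f.mapMatrix B) (f.mapMatrix C) D' *
      fromBlocks D' 0 (-f.mapMatrix C) 1 =
      fromBlocks (f.mapMatrix A * D' - f.mapMatrix B * f.mapMatrix C) (f.mapMatrix B) 0 D' := by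
    rw [fromBlocks_multiply]
    rw [mul_neg, hC, mul_neg, mul_zero, mul_zero, mul_one, mul_one, zero_add, zero_add,
      add_neg_cancel, sub_eq_add_neg]
  have h2 := congrArg Matrix.det h1
  rw [det_mul, det_fromBlocks_zero₁₂, det_fromBlocks_zero₂₁, det_one, mul_one] at h2
  have hD0 : D'.det ≠ 0 := by
    have : D' = charmatrix (-D) := by
      ext i j
      simp [hD', charmatrix_apply, f, Matrix.one_apply, diagonal_apply]
      split_ifs <;> simp [add_comm]
    rw [this]
    exact (charpoly_monic (-D)).ne_zero
  have h3 := congrArg (Polynomial.evalRingHom (0 : ℂ)) (mul_right_cancel₀ hD0 h2)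
  rw [RingHom.map_det, RingHom.map_det] at h3
  have hf : ∀ M : Matrix ι ι ℂ, (evalRingHom (0 : ℂ)).mapMatrix (f.mapMatrix M) = M := by
    intro M; ext i j; simp [f]
  have hD0 : (evalRingHom (0 : ℂ)).mapMatrix D' = D := by
    rw [hD', map_add, hf]; ext i j
    by_cases h : i = j <;> simp [h]
  rw [map_sub, map_mul, map_mul, hf, hf, hf, hD0] at h3
  rw [← h3]
  congr 1
  ext i j
  rcases i with i | i <;> rcases j with j | j
  · exact (congrFun₂ (hf A) i j).symm
  · exact (congrFun₂ (hf B) i j).symm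
  · exact (congrFun₂ (hf C) i j).symm
  · exact (congrFun₂ hD0 i j).symm

/-- The matrix which moves the basis vector `n` to `u n` times the basis vector `σ n`. -/
def weightedPerm {ι : Type*} [DecidableEq ι] (σ : Equiv.Perm ι) (u : ι → ℂ) : Matrix ι ι ℂ :=
  Matrix.of fun m n => if m = σ n then u n else 0

section weightedPerm

variable {ι : Type*} [Fintype ι] [DecidableEq ι]

theorem weightedPerm_mul (σ ρ : Equiv.Perm ι) (u v : ι → ℂ) :
    weightedPerm σ u * weightedPerm ρ v = weightedPerm (σ * ρ) fun n => u (ρ n) * v n := by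
  ext m n
  simp [weightedPerm, Matrix.mul_apply]
  congr

omit [Fintype ι] in
theorem weightedPerm_one : weightedPerm (1 : Equiv.Perm ι) (fun _ => 1) = 1 := by
  ext m n
  simp [weightedPerm, Matrix.one_apply]
  congr

omit [Fintype ι] in
theorem weightedPerm_transpose (σ : Equiv.Perm ι) (u : ι → ℂ) :
    (weightedPerm σ u).transpose = weightedPerm σ⁻¹ fun n => u (σ⁻¹ n) := by
  ext m n
  by_cases h : n = σ m
  · subst h; simp [weightedPerm]
  · have : m ≠ σ⁻¹ n := fun h' => h (by simp [h'])
    simp [weightedPerm, h]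
    exact fun h' => absurd h' this

/-- The determinant of `1` minus a weighted full cycle `σ`. In the Leibniz expansion a permutation
contributes only if it moves every point `i` to `i` or to `σ i`, and this leaves the identity and
`σ` itself. -/
theorem det_one_sub_weightedPerm (σ : Equiv.Perm ι) (hσ : ∀ a b, σ.SameCycle a b)
    (hf : ∀ a, σ a ≠ a) [Nonempty ι] (u : ι → ℂ) :
    (1 - weightedPerm σ u).det = 1 - ∏ n, u n := by
  have hcyc : σ.IsCycle := by
    obtain ⟨a⟩ := ‹Nonempty ι›
    exact ⟨a, hf a, fun b _ => hσ a b⟩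
  have hsupp : σ.support = Finset.univ := by
    ext a; simp [hf]
  have h1σ : (1 : Equiv.Perm ι) ≠ σ := fun h => by
    obtain ⟨a⟩ := ‹Nonempty ι›
    exact hf a (by rw [← h]; rfl)
  have hzero : ∀ π : Equiv.Perm ι, π ≠ 1 ∧ π ≠ σ →
      Equiv.Perm.sign π • ∏ i, (1 - weightedPerm σ u) (π i) i = 0 := by
    rintro π ⟨hπ1, hπσ⟩
    suffices ∃ i, π i ≠ i ∧ π i ≠ σ i by
      obtain ⟨i, h1, h2⟩ := this
      rw [Finset.prod_eq_zero (Finset.mem_univ i), smul_zero]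
      simp [weightedPerm, h1, h2]
    by_contra! hcon
    obtain ⟨a, ha⟩ : ∃ a, π a ≠ a := by
      by_contra! h
      exact hπ1 (Equiv.ext h)
    -- `π` is injective, so following `σ` at `b` forbids fixing `σ b`
    have hstep : ∀ b, π b = σ b → π (σ b) = σ (σ b) := by
      intro b hb
      refine hcon _ fun h => hf b ?_
      rw [← hb] at h
      rw [← hb]; exact π.injective h
    apply hπσ
    ext b
    obtain ⟨k, -, -, rfl⟩ := (hσ a b).exists_pow_eq σ
    suffices ∀ k : ℕ, π ((σ ^ k) a) = σ ((σ ^ k) a) from this k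
    intro k
    induction k with
    | zero => exact hcon a ha
    | succ k ih => rw [pow_succ']; exact hstep _ ih
  rw [Matrix.det_apply, Fintype.sum_eq_add 1 σ h1σ hzero]
  have e1 : ∀ i, (1 - weightedPerm σ u) i i = 1 := fun i => by
    simp [weightedPerm, (hf i).symm]
  have e2 : ∀ i, (1 - weightedPerm σ u) (σ i) i = -u i := fun i => by
    simp [weightedPerm, hf i]
  simp only [Equiv.Perm.coe_one, id, e1, e2, Equiv.Perm.sign_one, Finset.prod_const_one,
    hcyc.sign, hsupp, Finset.prod_neg, one_smul]
  rcases Nat.even_or_odd (Finset.univ : Finset ι).card with h | h <;>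
    rw [h.neg_one_pow, h.neg_one_pow] <;> simp [sub_eq_add_neg]

end weightedPerm

/-! ### Quaternions and the Haar measure of `SU(2)` -/

/-- The quaternion with coordinates `w`, as a complex matrix. Its first row is `w`, and
`quat w` is `√(|w.1|² + |w.2|²)` times an element of `SU(2)`. -/
def quat (w : ℂ × ℂ) : Matrix (Fin 2) (Fin 2) ℂ := !![w.1, w.2; -conj w.2, conj w.1]

/-- The squared Euclidean norm on `ℂ × ℂ`, whose own norm is the supremum norm. -/
def nsq (w : ℂ × ℂ) : ℝ := ‖w.1‖ ^ 2 + ‖w.2‖ ^ 2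

theorem nsq_nonneg (w : ℂ × ℂ) : 0 ≤ nsq w := by unfold nsq; positivity

theorem nsq_eq_zero {w : ℂ × ℂ} : nsq w = 0 ↔ w = 0 := by
  unfold nsq
  rw [add_eq_zero_iff_of_nonneg (by positivity) (by positivity)]
  simp [Prod.ext_iff]

theorem continuous_nsq : Continuous nsq := by unfold nsq; fun_prop

theorem continuous_quat : Continuous quat := by
  unfold quat
  refine continuous_matrix fun i j => ?_
  fin_cases i <;> fin_cases j <;> simp <;> fun_prop

theorem quat_mem {w : ℂ × ℂ} (h : nsq w = 1) :
    quat w ∈ Matrix.specialUnitaryGroup (Fin 2) ℂ := by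
  have h' : w.1 * conj w.1 + w.2 * conj w.2 = 1 := by
    rw [Complex.mul_conj', Complex.mul_conj']; unfold nsq at h; exact_mod_cast h
  rw [Matrix.mem_specialUnitaryGroup_iff, Matrix.mem_unitaryGroup_iff]
  constructor
  · ext i j
    fin_cases i <;> fin_cases j <;>
      simp [quat, Matrix.mul_apply, Fin.sum_univ_two, Matrix.star_apply]
    · exact h'
    · ring
    · ring
    · linear_combination h'
  · simp [quat, Matrix.det_fin_two]
    linear_combination h'

instance : SecondCountableTopology SU2 := by
  have : SecondCountableTopology (Matrix (Fin 2) (Fin 2) ℂ) :=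
    inferInstanceAs (SecondCountableTopology (Fin 2 → Fin 2 → ℂ))
  exact TopologicalSpace.Subtype.secondCountableTopology _

/-- An element of `SU(2)` is a unit quaternion. -/
theorem SU2.eq_quat (g : SU2) : (g : Matrix (Fin 2) (Fin 2) ℂ) = quat (g.1 0 0, g.1 0 1) := by
  obtain ⟨g, hg⟩ := g
  rw [Matrix.mem_specialUnitaryGroup_iff] at hg
  have h1 := Matrix.mem_unitaryGroup_iff.mp hg.1
  have h2 := hg.2
  have hinv : star g = g.adjugate := by
    have := congrArg (g.adjugate * ·) h1
    simp only [← mul_assoc, Matrix.adjugate_mul, h2, one_smul, one_mul, mul_one] at this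
    exact this
  have e00 := congrFun₂ hinv 0 0
  have e10 := congrFun₂ hinv 1 0
  simp [Matrix.adjugate_fin_two, Matrix.star_apply] at e00 e10
  ext i j
  fin_cases i <;> fin_cases j <;> simp [quat, e00, e10]

theorem SU2.nsq_row (g : SU2) : nsq (g.1 0 0, g.1 0 1) = 1 := by
  have h2 := (Matrix.mem_specialUnitaryGroup_iff.mp g.2).2
  rw [SU2.eq_quat g, Matrix.det_fin_two] at h2
  simp [quat, Complex.mul_conj'] at h2
  unfold nsq
  exact_mod_cast h2

theorem nsq_smul (r : ℝ) (w : ℂ × ℂ) : nsq (r • w) = r ^ 2 * nsq w := by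
  simp [nsq, mul_pow]; ring

theorem quat_smul (r : ℝ) (w : ℂ × ℂ) : quat (r • w) = (r : ℂ) • quat w := by
  ext i j
  fin_cases i <;> fin_cases j <;> simp [quat]

theorem nsq_normalize {w : ℂ × ℂ} (h : w ≠ 0) : nsq ((√(nsq w))⁻¹ • w) = 1 := by
  have h0 : nsq w ≠ 0 := fun h' => h (nsq_eq_zero.mp h')
  rw [nsq_smul, inv_pow, Real.sq_sqrt (nsq_nonneg w), inv_mul_cancel₀ h0]

/-- The direction in `SU(2)` of the quaternion with coordinates `w` (`1` if `w = 0`). -/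
def dir (w : ℂ × ℂ) : SU2 :=
  if h : w = 0 then 1 else ⟨quat ((√(nsq w))⁻¹ • w), quat_mem (nsq_normalize h)⟩

theorem smul_dir (w : ℂ × ℂ) :
    (√(nsq w) : ℂ) • (dir w : Matrix (Fin 2) (Fin 2) ℂ) = quat w := by
  by_cases h : w = 0
  · subst h
    ext i j
    fin_cases i <;> fin_cases j <;> simp [nsq, quat]
  · have h0 : nsq w ≠ 0 := fun h' => h (nsq_eq_zero.mp h')
    have h1 : √(nsq w) ≠ 0 := by rw [Real.sqrt_ne_zero (nsq_nonneg w)]; exact h0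
    simp only [dir, h, dite_false]
    rw [quat_smul, smul_smul, ← Complex.ofReal_mul, mul_inv_cancel₀ h1]
    simp

theorem measurable_dir : Measurable dir := by
  refine measurable_of_continuousOn_compl_singleton 0 ?_
  rw [continuousOn_iff_continuous_domRestrict, continuous_induced_rng]
  have : (Subtype.val ∘ Set.domRestrict {0}ᶜ dir) =
      fun w : ({0}ᶜ : Set (ℂ × ℂ)) => quat ((√(nsq w))⁻¹ • (w : ℂ × ℂ)) := by
    ext1 w
    have : (w : ℂ × ℂ) ≠ 0 := w.2
    simp [dir, this, Set.domRestrict]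
  rw [this]
  have hc : Continuous fun w : ({0}ᶜ : Set (ℂ × ℂ)) => (√(nsq (w : ℂ × ℂ)))⁻¹ := by
    refine Continuous.inv₀ (Real.continuous_sqrt.comp
      (continuous_nsq.comp continuous_subtype_val)) fun w => ?_
    rw [Real.sqrt_ne_zero (nsq_nonneg _)]
    exact fun h' => w.2 (nsq_eq_zero.mp h')
  exact continuous_quat.comp (hc.smul continuous_subtype_val)

/-- Left multiplication by `g` on quaternions, in coordinates. -/
def leftMul (g : SU2) (w : ℂ × ℂ) : ℂ × ℂ :=
  (g.1 0 0 * w.1 - g.1 0 1 * conj w.2, g.1 0 0 * w.2 + g.1 0 1 * conj w.1)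

theorem quat_leftMul (g : SU2) (w : ℂ × ℂ) : quat (leftMul g w) = g.1 * quat w := by
  rw [SU2.eq_quat g]
  ext i j
  fin_cases i <;> fin_cases j <;> simp [quat, leftMul, Matrix.mul_apply, Fin.sum_univ_two] <;> ring

theorem ofReal_nsq (w : ℂ × ℂ) : (nsq w : ℂ) = (quat w).det := by
  simp [nsq, quat, Matrix.det_fin_two, Complex.mul_conj']

theorem nsq_leftMul (g : SU2) (w : ℂ × ℂ) : nsq (leftMul g w) = nsq w := by
  have : (nsq (leftMul g w) : ℂ) = nsq w := by
    rw [ofReal_nsq, quat_leftMul, Matrix.det_mul,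
      (Matrix.mem_specialUnitaryGroup_iff.mp g.2).2, one_mul, ofReal_nsq]
  exact_mod_cast this

theorem dir_leftMul (g : SU2) {w : ℂ × ℂ} (hw : w ≠ 0) : dir (leftMul g w) = g * dir w := by
  have h0 : nsq w ≠ 0 := fun h' => hw (nsq_eq_zero.mp h')
  have h1 : (√(nsq w) : ℂ) ≠ 0 := by
    exact_mod_cast (Real.sqrt_ne_zero (nsq_nonneg w)).mpr h0
  apply Subtype.ext
  apply smul_right_injective _ h1
  have := smul_dir (leftMul g w)
  rw [nsq_leftMul, quat_leftMul, ← smul_dir w] at this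
  simpa using this

theorem nsq_eq_norm (w : ℂ × ℂ) : nsq w = ‖WithLp.toLp 2 w‖ ^ 2 := by
  rw [WithLp.prod_norm_sq_eq_of_L2]; rfl

theorem measurePreserving_leftMul (g : SU2) : MeasurePreserving (leftMul g) := by
  let f : WithLp 2 (ℂ × ℂ) →ₗᵢ[ℝ] WithLp 2 (ℂ × ℂ) :=
    { toFun := fun w => WithLp.toLp 2 (leftMul g (WithLp.ofLp w))
      map_add' := fun v w => by
        rw [← WithLp.toLp_add]; congr 1
        ext <;> simp [leftMul] <;> ring
      map_smul' := fun r w => by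
        rw [RingHom.id_apply, ← WithLp.toLp_smul]; congr 1
        ext <;> simp [leftMul] <;> ring
      norm_map' := fun w => by
        have := nsq_leftMul g (WithLp.ofLp w)
        rw [nsq_eq_norm, nsq_eq_norm] at this
        exact (pow_left_inj₀ (norm_nonneg _) (norm_nonneg _) two_ne_zero).mp this }
  have h1 := (f.toLinearIsometryEquiv rfl).measurePreserving
  exact (WithLp.volume_preserving_ofLp ℂ ℂ).comp (h1.comp (WithLp.volume_preserving_toLp ℂ ℂ))

/-- The density `exp (-r²) rᵈ` in the radius `r` on quaternions. -/
def radialDensity (d : ℕ) (w : ℂ × ℂ) : ℝ := Real.exp (-nsq w) * √(nsq w) ^ d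

theorem radialDensity_nonneg (d : ℕ) (w : ℂ × ℂ) : 0 ≤ radialDensity d w := by
  unfold radialDensity; positivity

theorem continuous_radialDensity (d : ℕ) : Continuous (radialDensity d) := by
  unfold radialDensity
  have := continuous_nsq
  fun_prop

/-- The total mass of the radial density. The volume of the unit ball is eliminated by comparison
with `d = 0`, where the integral is Gaussian. -/
theorem integral_radialDensity (d : ℕ) :
    ∫ w, radialDensity d w = Real.pi ^ 2 * Real.Gamma (d / 2 + 2) := by
  have h1 : ∀ d : ℕ, ∫ w, radialDensity d w =
      ∫ w : WithLp 2 (ℂ × ℂ), (fun r : ℝ => Real.exp (-r ^ 2) * r ^ d) ‖w‖ := by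
    intro d
    rw [← (WithLp.volume_preserving_ofLp ℂ ℂ).integral_comp
      (MeasurableEquiv.toLp 2 (ℂ × ℂ)).symm.measurableEmbedding]
    refine integral_congr_ae (Filter.Eventually.of_forall fun w => ?_)
    simp only [radialDensity]
    rw [nsq_eq_norm, WithLp.toLp_ofLp, Real.sqrt_sq (norm_nonneg _)]
  have hfin : Module.finrank ℝ (WithLp 2 (ℂ × ℂ)) = 4 := by
    rw [(WithLp.linearEquiv 2 ℝ (ℂ × ℂ)).finrank_eq, Module.finrank_prod]
    simp
  have h2 : ∀ d : ℕ, ∫ w, radialDensity d w =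
      4 * (volume.real (Metric.ball (0 : WithLp 2 (ℂ × ℂ)) 1)) *
        (1 / 2 * Real.Gamma (d / 2 + 2)) := by
    intro d
    rw [h1, integral_fun_norm_addHaar volume fun r : ℝ => Real.exp (-r ^ 2) * r ^ d, hfin]
    have : ∫ y in Set.Ioi (0 : ℝ), y ^ (4 - 1) • (Real.exp (-y ^ 2) * y ^ d) =
        ∫ y in Set.Ioi (0 : ℝ), y ^ ((d : ℝ) + 3) * Real.exp (-y ^ (2 : ℝ)) := by
      refine setIntegral_congr_fun measurableSet_Ioi fun y hy => ?_
      have e : ((d : ℝ) + 3) = ((d + 3 : ℕ) : ℝ) := by push_cast; ring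
      simp only [smul_eq_mul]
      rw [e, Real.rpow_natCast, Real.rpow_two]
      ring
    rw [this, integral_rpow_mul_exp_neg_rpow two_pos
      (by linarith [(Nat.cast_nonneg d : (0 : ℝ) ≤ d)])]
    simp only [nsmul_eq_mul, smul_eq_mul, Nat.cast_ofNat]
    rw [show ((d : ℝ) + 3 + 1) / 2 = d / 2 + 2 by ring]
    ring
  have h3 := h2 0
  rw [h1] at h3
  have h4 := GaussianFourier.integral_rexp_neg_mul_sq_norm (V := WithLp 2 (ℂ × ℂ)) (b := 1) one_pos
  rw [hfin] at h4
  simp only [pow_zero, mul_one] at h3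
  simp only [neg_mul, one_mul, div_one] at h4
  rw [h4] at h3
  norm_num [Real.Gamma_two] at h3
  rw [h2, h3]
  ring

theorem integrable_radialDensity (d : ℕ) : Integrable (radialDensity d) := by
  by_contra h
  have := integral_undef h
  rw [integral_radialDensity] at this
  have h2 : 0 < Real.Gamma ((d : ℝ) / 2 + 2) := Real.Gamma_pos_of_pos (by positivity)
  have := Real.pi_pos
  simp_all

/-- In polar coordinates, Lebesgue measure on quaternions induces a multiple of Haar measure on the
directions, whatever the radial density: the image is invariant under left multiplication. -/
theorem map_dir_radial (d : ℕ) :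
    Measure.map dir (volume.withDensity fun w => ENNReal.ofReal (radialDensity d w)) =
      ENNReal.ofReal (Real.pi ^ 2 * Real.Gamma (d / 2 + 2)) • haarSU2 := by
  set ν := volume.withDensity fun w => ENNReal.ofReal (radialDensity d w) with hν
  have hmeas : Measurable fun w => ENNReal.ofReal (radialDensity d w) :=
    (continuous_radialDensity d).measurable.ennreal_ofReal
  have huniv : Measure.map dir ν Set.univ =
      ENNReal.ofReal (Real.pi ^ 2 * Real.Gamma (d / 2 + 2)) := by
    rw [Measure.map_apply measurable_dir MeasurableSet.univ, Set.preimage_univ, hν,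
      withDensity_apply _ MeasurableSet.univ, Measure.restrict_univ,
      ← ofReal_integral_eq_lintegral_ofReal (integrable_radialDensity d)
        (Filter.Eventually.of_forall (radialDensity_nonneg d)), integral_radialDensity]
  have : IsFiniteMeasure (Measure.map dir ν) := ⟨by rw [huniv]; exact ENNReal.ofReal_lt_top⟩
  have : (Measure.map dir ν).IsMulLeftInvariant := by
    refine ⟨fun g => ?_⟩
    have hL := measurePreserving_leftMul g
    have hLν : Measure.map (leftMul g) ν = ν := by
      ext s hs
      rw [Measure.map_apply hL.measurable hs, hν, withDensity_apply _ (hL.measurable hs),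
        withDensity_apply _ hs, ← hL.setLIntegral_comp_preimage hs hmeas]
      simp only [radialDensity, nsq_leftMul]
    conv_rhs => rw [← hLν]
    rw [Measure.map_map (measurable_const_mul g) measurable_dir,
      Measure.map_map measurable_dir hL.measurable]
    refine Measure.map_congr ?_
    -- equivariance of `dir` fails only at the origin, a null set
    have h0 : ∀ᵐ w ∂(volume : Measure (ℂ × ℂ)), w ≠ 0 := by
      rw [ae_iff, Measure.volume_eq_prod]
      simp
    filter_upwards [(withDensity_absolutelyContinuous _ _).ae_le h0] with w hw
    exact (dir_leftMul g hw).symm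
  rw [Measure.haarMeasure_unique (Measure.map dir ν) (⊤ : TopologicalSpace.PositiveCompacts SU2)]
  rw [TopologicalSpace.PositiveCompacts.coe_top, huniv]
  rfl

theorem pi_withDensity_ofReal {ι X : Type*} [Fintype ι] [MeasurableSpace X] (μ : Measure X)
    [SigmaFinite μ] {f : ι → X → ℝ} (hf : ∀ i, Integrable (f i) μ) (h0 : ∀ i x, 0 ≤ f i x) :
    Measure.pi (fun i => μ.withDensity fun x => ENNReal.ofReal (f i x)) =
      (Measure.pi fun _ => μ).withDensity fun x => ENNReal.ofReal (∏ i, f i (x i)) := by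
  have hfin : ∀ i, IsFiniteMeasure (μ.withDensity fun x => ENNReal.ofReal (f i x)) :=
    fun i => isFiniteMeasure_withDensity_ofReal (hf i).2
  refine Measure.pi_eq fun s hs => ?_
  rw [withDensity_apply _ (MeasurableSet.univ_pi hs), Measure.restrict_pi_pi]
  rw [← ofReal_integral_eq_lintegral_ofReal
    (Integrable.fintype_prod_dep fun i => (hf i).restrict)
    (Filter.Eventually.of_forall fun x => Finset.prod_nonneg fun i _ => h0 i _)]
  rw [integral_fintype_prod_eq_prod, ENNReal.ofReal_prod_of_nonneg
    fun i _ => integral_nonneg (h0 i)]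
  refine Finset.prod_congr rfl fun i _ => ?_
  rw [withDensity_apply _ (hs i), ofReal_integral_eq_lintegral_ofReal (hf i).restrict
    (Filter.Eventually.of_forall (h0 i))]

theorem pi_ofReal_smul {ι X : Type*} [Fintype ι] [MeasurableSpace X] (μ : Measure X)
    [SigmaFinite μ] (c : ι → ℝ) :
    Measure.pi (fun i => ENNReal.ofReal (c i) • μ) =
      (∏ i, ENNReal.ofReal (c i)) • Measure.pi fun _ => μ := by
  have : ∀ i, SigmaFinite (ENNReal.ofReal (c i) • μ) := fun i =>
    inferInstanceAs (SigmaFinite ((c i).toNNReal • μ))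
  refine Measure.pi_eq fun s _ => ?_
  simp [Measure.pi_pi, Finset.prod_mul_distrib]

/-- Haar integrals over several copies of `SU(2)` as integrals over quaternions. -/
theorem integral_haar_pi {ι : Type*} [Fintype ι] (d : ι → ℕ) {P : (ι → SU2) → ℂ}
    (hP : Continuous P) :
    ((∏ i, (Real.pi ^ 2 * Real.Gamma (d i / 2 + 2)) : ℝ) : ℂ) *
        ∫ g, P g ∂(Measure.pi fun _ => haarSU2) =
      ∫ w : ι → ℂ × ℂ, ((∏ i, radialDensity (d i) (w i) : ℝ) : ℂ) * P fun i => dir (w i) := by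
  have h1 := Measure.pi_map_pi (μ := fun i => (volume : Measure (ℂ × ℂ)).withDensity
    fun w => ENNReal.ofReal (radialDensity (d i) w)) (f := fun _ => dir)
    (hμ := fun i => by rw [map_dir_radial]; exact
      inferInstanceAs (SigmaFinite ((Real.pi ^ 2 * Real.Gamma (d i / 2 + 2)).toNNReal • haarSU2)))
    fun i => measurable_dir.aemeasurable
  simp_rw [map_dir_radial] at h1
  rw [pi_ofReal_smul, pi_withDensity_ofReal _ (fun i => integrable_radialDensity (d i))
    fun i => radialDensity_nonneg (d i)] at h1
  have hpos : ∀ i, 0 ≤ Real.pi ^ 2 * Real.Gamma ((d i : ℝ) / 2 + 2) := fun i =>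
    mul_nonneg (sq_nonneg _) (Real.Gamma_pos_of_pos (by positivity)).le
  have hm : Measurable fun (w : ι → ℂ × ℂ) i => dir (w i) :=
    measurable_pi_lambda _ fun i => measurable_dir.comp (measurable_pi_apply i)
  have hF : Measurable fun w : ι → ℂ × ℂ => ∏ i, radialDensity (d i) (w i) :=
    (continuous_finsetProd _ fun i _ => (continuous_radialDensity (d i)).comp
      (continuous_apply i)).measurable
  have h2 := congrArg (fun m => ∫ g, P g ∂m) h1
  beta_reduce at h2
  rw [integral_map hm.aemeasurable hP.aestronglyMeasurable, integral_smul_measure,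
    integral_withDensity_eq_integral_toReal_smul hF.ennreal_ofReal
      (Filter.Eventually.of_forall fun _ => ENNReal.ofReal_lt_top),
    ← ENNReal.ofReal_prod_of_nonneg fun i _ => hpos i,
    ENNReal.toReal_ofReal (Finset.prod_nonneg fun i _ => hpos i)] at h2
  rw [Complex.real_smul] at h2
  rw [← h2, volume_pi]
  refine integral_congr_ae (Filter.Eventually.of_forall fun w => ?_)
  beta_reduce
  rw [ENNReal.toReal_ofReal (Finset.prod_nonneg fun i _ => radialDensity_nonneg _ _),
    Complex.real_smul]

/-! ### The sum over spins as a Gaussian integral -/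

/-- The extension of `⟨ξ| g'⁻¹ h g |ξ⟩` to quaternions `g' = quat w'`, `g = quat w`. -/
def linkForm (ξ : Fin 2 → ℂ) (h : SU2) (w' w : ℂ × ℂ) : ℂ :=
  star ξ ⬝ᵥ (((quat w').conjTranspose * h * quat w).mulVec ξ)

theorem linkForm_eq (ξ : Fin 2 → ℂ) (h : SU2) (w' w : ℂ × ℂ) :
    linkForm ξ h w' w = √(nsq w') * √(nsq w) * matrixElement ξ ((dir w')⁻¹ * h * dir w) := by
  rw [linkForm, matrixElement, ← smul_dir w', ← smul_dir w]
  simp only [Matrix.conjTranspose_smul, RCLike.star_def, Complex.conj_ofReal, Matrix.smul_mul,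
    Matrix.mul_smul, Matrix.smul_mulVec, dotProduct_smul, smul_eq_mul, ← mul_assoc]
  rw [mul_comm (√(nsq w) : ℂ)]
  rfl

theorem continuous_matrixElement (ξ : Fin 2 → ℂ) : Continuous (matrixElement ξ) := by
  unfold matrixElement
  fun_prop

theorem continuous_linkForm (ξ : Fin 2 → ℂ) (h : SU2) {X : Type*} [TopologicalSpace X]
    {f g : X → ℂ × ℂ} (hf : Continuous f) (hg : Continuous g) :
    Continuous fun x => linkForm ξ h (f x) (g x) := by
  unfold linkForm
  have := continuous_quat
  fun_prop

theorem norm_matrixElement_up (g : SU2) : ‖matrixElement spinorUp g‖ ≤ 1 := by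
  simpa [matrixElement, spinorUp, Matrix.mulVec, dotProduct, Fin.sum_univ_two] using
    SU2.norm_entry_le_one g 0 0

theorem inv_sqrt_two_mul_self : ((√2 : ℂ))⁻¹ * ((√2 : ℂ))⁻¹ = 1 / 2 := by
  rw [← mul_inv, ← Complex.ofReal_mul, Real.mul_self_sqrt zero_le_two]
  norm_num

/-- The sharp bound is `1`; the factor `2` only shrinks the region of small couplings considered
below. -/
theorem norm_matrixElement_plus (g : SU2) : ‖matrixElement spinorPlus g‖ ≤ 2 := by
  have h1 := SU2.norm_entry_le_one g
  have : matrixElement spinorPlus g = 1 / 2 * (g.1 0 0 + g.1 0 1 + g.1 1 0 + g.1 1 1) := by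
    rw [← inv_sqrt_two_mul_self]
    simp [matrixElement, spinorPlus, Matrix.mulVec, dotProduct, Fin.sum_univ_two]
    ring
  rw [this, norm_mul]
  have h2 : ‖g.1 0 0 + g.1 0 1 + g.1 1 0 + g.1 1 1‖ ≤ 1 + 1 + 1 + 1 :=
    norm_add_le_of_le (norm_add_le_of_le (norm_add_le_of_le (h1 0 0) (h1 0 1)) (h1 1 0)) (h1 1 1)
  norm_num
  linarith

theorem norm_linkForm_le {ξ : Fin 2 → ℂ} {c : ℝ} (hξ : ∀ g, ‖matrixElement ξ g‖ ≤ c) (h : SU2)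
    (w' w : ℂ × ℂ) : ‖linkForm ξ h w' w‖ ≤ c * ((nsq w' + nsq w) / 2) := by
  have hc : 0 ≤ c := (norm_nonneg _).trans (hξ 1)
  rw [linkForm_eq, norm_mul, norm_mul, Complex.norm_real, Complex.norm_real, Real.norm_eq_abs,
    Real.norm_eq_abs, abs_of_nonneg (Real.sqrt_nonneg _), abs_of_nonneg (Real.sqrt_nonneg _),
    mul_comm c]
  refine mul_le_mul ?_ (hξ _) (norm_nonneg _) (by linarith [nsq_nonneg w, nsq_nonneg w'])
  have := sq_nonneg (√(nsq w') - √(nsq w))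
  nlinarith [Real.sq_sqrt (nsq_nonneg w), Real.sq_sqrt (nsq_nonneg w')]

section Lattice

variable {Nt Nx : ℕ} [NeZero Nt] [NeZero Nx]

/-- `right` as a permutation of the nodes. -/
def rightPerm : Equiv.Perm (Node Nt Nx) where
  toFun := right
  invFun := left
  left_inv n := by simp [left, right]
  right_inv n := by simp [left, right]

/-- `next` as a permutation of the nodes. -/
def nextPerm (Nγ : ℤ) : Equiv.Perm (Node Nt Nx) where
  toFun := next Nγ
  invFun := prev Nγ
  left_inv := prev_next Nγ
  right_inv := next_prev Nγ

variable (Nγ : ℤ)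

/-- The exponent of the Gaussian integral: the link forms, weighted by the couplings. -/
def action (hh hv : Node Nt Nx → SU2) (q : ℂ × ℂ) (w : Node Nt Nx → ℂ × ℂ) : ℂ :=
  ∑ n, (q.2 * linkForm spinorUp (hh n) (w (right n)) (w n) +
    q.1 * linkForm spinorPlus (hv n) (w (next Nγ n)) (w n))

theorem sum_norm_link_le (hh hv : Node Nt Nx → SU2) (q : ℂ × ℂ) (w : Node Nt Nx → ℂ × ℂ) :
    ∑ n, (‖q.2 * linkForm spinorUp (hh n) (w (right n)) (w n)‖ +
      ‖q.1 * linkForm spinorPlus (hv n) (w (next Nγ n)) (w n)‖) ≤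
    (‖q.2‖ + 2 * ‖q.1‖) * ∑ n, nsq (w n) := by
  have h1 : ∑ n, nsq (w (right n)) = ∑ n, nsq (w n) :=
    Equiv.sum_comp rightPerm fun n => nsq (w n)
  have h2 : ∑ n, nsq (w (next Nγ n)) = ∑ n, nsq (w n) :=
    Equiv.sum_comp (nextPerm Nγ) fun n => nsq (w n)
  calc _ ≤ ∑ n, (‖q.2‖ * (1 * ((nsq (w (right n)) + nsq (w n)) / 2)) +
        ‖q.1‖ * (2 * ((nsq (w (next Nγ n)) + nsq (w n)) / 2))) := by
        refine Finset.sum_le_sum fun n _ => ?_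
        rw [norm_mul, norm_mul]
        have a1 := norm_linkForm_le norm_matrixElement_up (hh n) (w (right n)) (w n)
        have a2 := norm_linkForm_le norm_matrixElement_plus (hv n) (w (next Nγ n)) (w n)
        gcongr
    _ = _ := by
        rw [Finset.sum_add_distrib, ← Finset.mul_sum, ← Finset.mul_sum, ← Finset.mul_sum,
          ← Finset.mul_sum, ← Finset.sum_div, ← Finset.sum_div, Finset.sum_add_distrib,
          Finset.sum_add_distrib, h1, h2]
        ring

/-- The Gamma weights turn the Haar integrals over the nodes into Gaussian integrals over
quaternions. The radius at a node appears to the power given by the spins of its four links, which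
is what the extension of the matrix elements to quaternions absorbs. -/
theorem prod_Gamma_mul_lsState (T L : Node Nt Nx → ℕ) (hh hv : Node Nt Nx → SU2) :
    (∏ n, ((Real.Gamma (nodeSpin Nt Nx Nγ T L n + 2) : ℝ) : ℂ)) * lsState Nt Nx Nγ T L hh hv =
      ((Real.pi : ℂ) ^ (2 * Fintype.card (Node Nt Nx)))⁻¹ *
        ∫ w : Node Nt Nx → ℂ × ℂ, ((Real.exp (-∑ n, nsq (w n)) : ℝ) : ℂ) *
          ∏ n, (linkForm spinorUp (hh n) (w (right n)) (w n) ^ T n *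
            linkForm spinorPlus (hv n) (w (next Nγ n)) (w n) ^ L n) := by
  set d : Node Nt Nx → ℕ := fun n => T n + L n + T (left n) + L (prev Nγ n) with hd
  have hcont : Continuous fun g : Node Nt Nx → SU2 =>
      ∏ n, matrixElement spinorUp ((g (right n))⁻¹ * hh n * g n) ^ T n *
        matrixElement spinorPlus ((g (next Nγ n))⁻¹ * hv n * g n) ^ L n := by
    have h1 := continuous_matrixElement spinorUp
    have h2 := continuous_matrixElement spinorPlus
    fun_prop
  have h := integral_haar_pi d hcont
  have hspin : ∀ n, nodeSpin Nt Nx Nγ T L n + 2 = (d n : ℝ) / 2 + 2 := by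
    intro n; simp [nodeSpin, hd]
  have hπ : (Real.pi : ℂ) ≠ 0 := by exact_mod_cast Real.pi_ne_zero
  rw [eq_inv_mul_iff_mul_eq₀ (pow_ne_zero _ hπ), ← mul_assoc]
  have e1 : (Real.pi : ℂ) ^ (2 * Fintype.card (Node Nt Nx)) *
      ∏ n, ((Real.Gamma (nodeSpin Nt Nx Nγ T L n + 2) : ℝ) : ℂ) =
      ((∏ i, (Real.pi ^ 2 * Real.Gamma (d i / 2 + 2)) : ℝ) : ℂ) := by
    simp_rw [hspin]
    rw [Finset.prod_mul_distrib, Finset.prod_const, ← pow_mul]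
    push_cast
    rfl
  rw [e1, lsState, h]
  refine integral_congr_ae (Filter.Eventually.of_forall fun w => ?_)
  simp only [linkForm_eq, mul_pow, Finset.prod_mul_distrib, radialDensity, ← Real.exp_sum,
    Finset.sum_neg_distrib, hd, pow_add]
  have r1 : ∀ f : Node Nt Nx → ℂ, ∏ n, f (right n) ^ T n = ∏ n, f n ^ T (left n) := by
    intro f
    rw [← Equiv.prod_comp rightPerm fun n => f n ^ T (left n)]
    exact Finset.prod_congr rfl fun n _ => by simp [rightPerm, left, right]
  have r2 : ∀ f : Node Nt Nx → ℂ, ∏ n, f (next Nγ n) ^ L n = ∏ n, f n ^ L (prev Nγ n) := by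
    intro f
    rw [← Equiv.prod_comp (nextPerm Nγ) fun n => f n ^ L (prev Nγ n)]
    exact Finset.prod_congr rfl fun n _ => by simp [nextPerm, prev_next]
  rw [r1 fun n => (√(nsq (w n)) : ℂ), r2 fun n => (√(nsq (w n)) : ℂ)]
  push_cast
  ring

omit [NeZero Nt] in
theorem integrable_exp_nsq {c : ℝ} (hc : 0 < c) :
    Integrable fun w : Node Nt Nx → ℂ × ℂ => Real.exp (-(c * ∑ n, nsq (w n))) := by
  have h1 : Integrable fun w : WithLp 2 (ℂ × ℂ) => Real.exp (-c * ‖w‖ ^ 2) := by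
    have := (GaussianFourier.integrable_cexp_neg_mul_sq_norm_add (V := WithLp 2 (ℂ × ℂ)) (b := c)
          (by simpa using hc) 0 0).norm
    refine this.congr (Filter.Eventually.of_forall fun z => ?_)
    simp [Complex.norm_exp, ← Complex.ofReal_pow]
  have h2 : Integrable fun w : ℂ × ℂ => Real.exp (-c * nsq w) := by
    rw [← (WithLp.volume_preserving_ofLp ℂ ℂ).integrable_comp_emb
      (MeasurableEquiv.toLp 2 (ℂ × ℂ)).symm.measurableEmbedding]
    refine h1.congr (Filter.Eventually.of_forall fun z => ?_)
    simp [nsq_eq_norm]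
  refine (Integrable.fintype_prod (f := fun (_ : Node Nt Nx) w => Real.exp (-c * nsq w))
    fun _ => h2).congr (Filter.Eventually.of_forall fun w => ?_)
  simp only []
  rw [← Real.exp_sum, ← Finset.mul_sum, neg_mul]

/-- For small couplings the sum over spins converges to a Gaussian integral over quaternions: the
exponential series of the action is integrated term by term. -/
theorem hasSum_coherentTerm (hh hv : Node Nt Nx → SU2) {q : ℂ × ℂ} (hq : ‖q.2‖ + 2 * ‖q.1‖ < 1) :
    HasSum (coherentTerm Nt Nx Nγ hh hv q)
      (((Real.pi : ℂ) ^ (2 * Fintype.card (Node Nt Nx)))⁻¹ *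
        ∫ w : Node Nt Nx → ℂ × ℂ,
          Complex.exp (-(((∑ n, nsq (w n) : ℝ) : ℂ) - action Nγ hh hv q w))) := by
  set a : (Node Nt Nx → ℂ × ℂ) → Node Nt Nx → ℂ := fun w n =>
    q.2 * linkForm spinorUp (hh n) (w (right n)) (w n) with ha
  set b : (Node Nt Nx → ℂ × ℂ) → Node Nt Nx → ℂ := fun w n =>
    q.1 * linkForm spinorPlus (hv n) (w (next Nγ n)) (w n) with hb
  -- `F` is the integrand of each term and `B` the bound which dominates it
  obtain ⟨F, hF⟩ : ∃ F : (Node Nt Nx → ℕ) × (Node Nt Nx → ℕ) → (Node Nt Nx → ℂ × ℂ) → ℂ,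
      ∀ S w, F S w = ((Real.exp (-∑ n, nsq (w n)) : ℝ) : ℂ) *
      ((∏ n, a w n ^ S.1 n / ((S.1 n).factorial : ℂ)) *
        ∏ n, b w n ^ S.2 n / ((S.2 n).factorial : ℂ)) := ⟨_, fun _ _ => rfl⟩
  obtain ⟨B, hB⟩ : ∃ B : (Node Nt Nx → ℕ) × (Node Nt Nx → ℕ) → (Node Nt Nx → ℂ × ℂ) → ℝ,
      ∀ S w, B S w = Real.exp (-∑ n, nsq (w n)) *
      ((∏ n, ‖a w n‖ ^ S.1 n / ((S.1 n).factorial : ℝ)) *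
        ∏ n, ‖b w n‖ ^ S.2 n / ((S.2 n).factorial : ℝ)) := ⟨_, fun _ _ => rfl⟩
  have hterm : ∀ S, coherentTerm Nt Nx Nγ hh hv q S =
      ((Real.pi : ℂ) ^ (2 * Fintype.card (Node Nt Nx)))⁻¹ * ∫ w, F S w := by
    intro S
    have e : ∀ w, F S w = (∏ n, q.1 ^ S.2 n * q.2 ^ S.1 n /
        (((S.2 n).factorial : ℂ) * ((S.1 n).factorial : ℂ))) *
        (((Real.exp (-∑ n, nsq (w n)) : ℝ) : ℂ) *
          ∏ n, (linkForm spinorUp (hh n) (w (right n)) (w n) ^ S.1 n *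
            linkForm spinorPlus (hv n) (w (next Nγ n)) (w n) ^ S.2 n)) := by
      intro w
      simp only [hF, ha, hb]
      rw [← Finset.prod_mul_distrib, mul_left_comm, ← Finset.prod_mul_distrib]
      congr 1
      refine Finset.prod_congr rfl fun n _ => ?_
      rw [mul_pow, mul_pow]
      field_simp
    simp_rw [e]
    rw [integral_const_mul, mul_left_comm, ← prod_Gamma_mul_lsState, coherentTerm,
      Finset.prod_mul_distrib, mul_assoc]
  have hfun : coherentTerm Nt Nx Nγ hh hv q = fun S =>
      ((Real.pi : ℂ) ^ (2 * Fintype.card (Node Nt Nx)))⁻¹ * ∫ w, F S w := funext hterm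
  rw [hfun]
  generalize ((Real.pi : ℂ) ^ (2 * Fintype.card (Node Nt Nx)))⁻¹ = C
  have hca : ∀ n, Continuous fun w => a w n := fun n =>
    continuous_const.mul (continuous_linkForm _ _ (continuous_apply _) (continuous_apply n))
  have hcb : ∀ n, Continuous fun w => b w n := fun n =>
    continuous_const.mul (continuous_linkForm _ _ (continuous_apply _) (continuous_apply n))
  have hcn : Continuous fun w : Node Nt Nx → ℂ × ℂ => ∑ n, nsq (w n) :=
    continuous_finsetSum _ fun n _ => continuous_nsq.comp (continuous_apply n)
  have hexpF : ∀ w, HasSum (fun S => F S w)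
      (Complex.exp (-(((∑ n, nsq (w n) : ℝ) : ℂ) - action Nγ hh hv q w))) := by
    intro w
    have h := (hasSum_exp_pi_prod (a w) (b w)).mul_left ((Real.exp (-∑ n, nsq (w n)) : ℝ) : ℂ)
    simp only [← hF, ← Complex.exp_eq_exp_ℂ] at h
    rw [← Complex.exp_sum, ← Complex.exp_sum, Complex.ofReal_exp, ← Complex.exp_add,
      ← Complex.exp_add, ← Finset.sum_add_distrib] at h
    have e : -(((∑ n, nsq (w n) : ℝ) : ℂ) - action Nγ hh hv q w) =
        ((-∑ n, nsq (w n) : ℝ) : ℂ) + ∑ n, (a w n + b w n) := by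
      simp only [action, ha, hb]
      push_cast
      ring
    rw [e]
    exact h
  have hexpB : ∀ w, HasSum (fun S => B S w)
      (Real.exp (-∑ n, nsq (w n) + ∑ n, (‖a w n‖ + ‖b w n‖))) := by
    intro w
    have h := (hasSum_exp_pi_prod (fun n => ‖a w n‖) (fun n => ‖b w n‖)).mul_left
      (Real.exp (-∑ n, nsq (w n)))
    simp only [← hB, ← Real.exp_eq_exp_ℝ] at h
    rw [← Real.exp_sum, ← Real.exp_sum, ← Real.exp_add, ← Real.exp_add,
      ← Finset.sum_add_distrib] at h
    exact h
  have hmeas : ∀ S, AEStronglyMeasurable (F S) volume := by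
    intro S
    rw [show F S = _ from funext (hF S)]
    refine Continuous.aestronglyMeasurable ?_
    fun_prop
  have hbound : ∀ S, ∀ᵐ w, ‖F S w‖ ≤ B S w := by
    intro S
    refine Filter.Eventually.of_forall fun w => ?_
    simp only [hF, hB, norm_mul, norm_prod, norm_div, norm_pow, Complex.norm_natCast,
      Complex.norm_real, Real.norm_eq_abs, Real.abs_exp, le_refl]
  have hint : Integrable fun w => ∑' S, B S w := by
    simp_rw [fun w => (hexpB w).tsum_eq]
    refine (integrable_exp_nsq (sub_pos.mpr hq)).mono' ?_ ?_
    · refine Continuous.aestronglyMeasurable ?_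
      fun_prop
    · refine Filter.Eventually.of_forall fun w => ?_
      rw [Real.norm_eq_abs, Real.abs_exp]
      have := sum_norm_link_le Nγ hh hv q w
      refine Real.exp_le_exp.mpr ?_
      linarith
  have hsum := hasSum_integral_of_dominated_convergence B hmeas hbound
    (Filter.Eventually.of_forall fun w => (hexpB w).summable) hint
    (Filter.Eventually.of_forall hexpF)
  exact hsum.mul_left C

end Lattice

/-! ### Diagonal holonomies -/

/-- The diagonal element `diag(u, ū)` of `SU(2)`. -/
def diagSU2 (u : ℂ) (hu : ‖u‖ = 1) : SU2 :=
  ⟨quat (u, 0), quat_mem (by simp [nsq, hu])⟩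

theorem linkForm_up_one (w' w : ℂ × ℂ) :
    linkForm spinorUp 1 w' w = conj w'.1 * w.1 + w'.2 * conj w.2 := by
  simp [linkForm, spinorUp, quat, Matrix.mulVec, dotProduct, Fin.sum_univ_two, Matrix.mul_apply,
    Matrix.conjTranspose_apply]

theorem linkForm_plus_diag (u : ℂ) (hu : ‖u‖ = 1) (w' w : ℂ × ℂ) :
    linkForm spinorPlus (diagSU2 u hu) w' w = 1 / 2 *
      (u * (conj w'.1 + conj w'.2) * (w.1 + w.2) +
        conj u * (w'.1 - w'.2) * (conj w.1 - conj w.2)) := by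
  rw [← inv_sqrt_two_mul_self]
  simp [linkForm, spinorPlus, diagSU2, quat, Matrix.mulVec, dotProduct, Fin.sum_univ_two,
    Matrix.mul_apply, Matrix.conjTranspose_apply]
  ring

section Lattice

variable {Nt Nx : ℕ} [NeZero Nt] [NeZero Nx] (Nγ : ℤ)

/-- Translation by one step in space. -/
def shiftMat : Matrix (Node Nt Nx) (Node Nt Nx) ℂ := weightedPerm rightPerm fun _ => 1

/-- Translation by one step in time, with phases `u` on the vertical links. -/
def timeMat (u : Node Nt Nx → ℂ) : Matrix (Node Nt Nx) (Node Nt Nx) ℂ :=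
  weightedPerm (nextPerm Nγ) u

/-- The matrix of the Gaussian integral, for diagonal holonomies with phases `u`. Rows and columns
are indexed by the two components of the quaternions at the nodes. -/
def kernelMat (u : Node Nt Nx → ℂ) (q : ℂ × ℂ) :
    Matrix (Node Nt Nx ⊕ Node Nt Nx) (Node Nt Nx ⊕ Node Nt Nx) ℂ :=
  Matrix.fromBlocks
    (1 - q.2 • shiftMat - (q.1 / 2) • (timeMat Nγ u + (timeMat Nγ fun n => conj (u n)).transpose))
    (-((q.1 / 2) • (timeMat Nγ u - (timeMat Nγ fun n => conj (u n)).transpose)))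
    (-((q.1 / 2) • (timeMat Nγ u - (timeMat Nγ fun n => conj (u n)).transpose)))
    (1 - q.2 • shiftMat.transpose -
      (q.1 / 2) • (timeMat Nγ u + (timeMat Nγ fun n => conj (u n)).transpose))

open Matrix in
theorem dotProduct_weightedPerm_mulVec {ι : Type*} [Fintype ι] [DecidableEq ι]
    (σ : Equiv.Perm ι) (u x y : ι → ℂ) :
    x ⬝ᵥ weightedPerm σ u *ᵥ y = ∑ n, x (σ n) * u n * y n := by
  simp only [dotProduct, mulVec, weightedPerm, of_apply, Finset.mul_sum]
  rw [Finset.sum_comm]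
  refine Finset.sum_congr rfl fun n _ => ?_
  simp [mul_assoc]

open Matrix in
theorem dotProduct_weightedPerm_transpose_mulVec {ι : Type*} [Fintype ι] [DecidableEq ι]
    (σ : Equiv.Perm ι) (u x y : ι → ℂ) :
    x ⬝ᵥ (weightedPerm σ u)ᵀ *ᵥ y = ∑ n, x n * u n * y (σ n) := by
  rw [mulVec_transpose, dotProduct_comm, ← dotProduct_mulVec, dotProduct_weightedPerm_mulVec]
  exact Finset.sum_congr rfl fun n _ => by ring

open Matrix in
/-- The sesquilinear form of the kernel is the exponent of the Gaussian integral. -/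
theorem kernelMat_form (u : Node Nt Nx → ℂ) (hu : ∀ n, ‖u n‖ = 1) (q : ℂ × ℂ)
    (w : Node Nt Nx → ℂ × ℂ) :
    star (Sum.elim (fun n => (w n).1) fun n => (w n).2) ⬝ᵥ
      kernelMat Nγ u q *ᵥ Sum.elim (fun n => (w n).1) (fun n => (w n).2) =
      ((∑ n, nsq (w n) : ℝ) : ℂ) -
        action Nγ (fun _ => 1) (fun n => diagSU2 (u n) (hu n)) q w := by
  rw [kernelMat, fromBlocks_mulVec]
  have hstar : star (Sum.elim (fun n => (w n).1) fun n => (w n).2) =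
      Sum.elim (fun n => conj (w n).1) fun n => conj (w n).2 := by
    ext i; rcases i with i | i <;> rfl
  rw [hstar, sumElim_dotProduct_sumElim, Sum.elim_comp_inl, Sum.elim_comp_inr]
  simp only [sub_mulVec, add_mulVec, neg_mulVec, smul_mulVec, one_mulVec, dotProduct_sub,
    dotProduct_add, dotProduct_neg, dotProduct_smul, shiftMat, timeMat,
    dotProduct_weightedPerm_mulVec, dotProduct_weightedPerm_transpose_mulVec]
  simp only [dotProduct, smul_eq_mul, action, linkForm_up_one, linkForm_plus_diag, nsq, rightPerm,
    nextPerm, Equiv.coe_fn_mk, Finset.mul_sum, Complex.ofReal_sum, Complex.ofReal_add,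
    Complex.ofReal_pow, ← Complex.conj_mul']
  simp only [← Finset.sum_add_distrib, ← Finset.sum_sub_distrib, Finset.mul_sum,
    ← Finset.sum_neg_distrib]
  refine Finset.sum_congr rfl fun n _ => ?_
  ring

theorem integral_sum_elim {ι : Type*} [Fintype ι] (f : (ι ⊕ ι → ℂ) → ℂ) :
    ∫ w : ι → ℂ × ℂ, f (Sum.elim (fun n => (w n).1) fun n => (w n).2) = ∫ W, f W := by
  rw [← (volume_measurePreserving_sumPiEquivProdPi fun _ : ι ⊕ ι => ℂ).symm.integral_comp
    (MeasurableEquiv.measurableEmbedding _),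
    ← (volume_measurePreserving_arrowProdEquivProdArrow ℂ ℂ ι).integral_comp
    (MeasurableEquiv.measurableEmbedding _)]
  refine integral_congr_ae (Filter.Eventually.of_forall fun w => ?_)
  beta_reduce
  congr 1

/-- For small couplings the sum over all spins is the inverse of a determinant. -/
theorem hasSum_coherentTerm_diag (u : Node Nt Nx → ℂ) (hu : ∀ n, ‖u n‖ = 1) {q : ℂ × ℂ}
    (hq : ‖q.2‖ + 2 * ‖q.1‖ < 1) :
    HasSum (coherentTerm Nt Nx Nγ (fun _ => 1) (fun n => diagSU2 (u n) (hu n)) q)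
      (kernelMat Nγ u q).det⁻¹ := by
  have h1 := hasSum_coherentTerm Nγ (fun _ => 1) (fun n => diagSU2 (u n) (hu n)) hq
  have h2 := integral_gaussian_matrix (kernelMat Nγ u q) (sub_pos.mpr hq) (by
    intro W
    set w : Node Nt Nx → ℂ × ℂ := fun n => (W (Sum.inl n), W (Sum.inr n)) with hw
    have hW : W = Sum.elim (fun n => (w n).1) fun n => (w n).2 := by
      ext i; rcases i with i | i <;> rfl
    have hn : ∑ i, ‖W i‖ ^ 2 = ∑ n, nsq (w n) := by
      rw [Fintype.sum_sum_type, ← Finset.sum_add_distrib]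
      rfl
    rw [hn]
    rw [hW, kernelMat_form Nγ u hu, Complex.sub_re, Complex.ofReal_re]
    have h3 := sum_norm_link_le Nγ (fun _ => 1) (fun n => diagSU2 (u n) (hu n)) q w
    have h4 : (action Nγ (fun _ => 1) (fun n => diagSU2 (u n) (hu n)) q w).re ≤
        (‖q.2‖ + 2 * ‖q.1‖) * ∑ n, nsq (w n) := by
      refine (Complex.re_le_norm _).trans (le_trans ?_ h3)
      exact (norm_sum_le _ _).trans (Finset.sum_le_sum fun n _ => norm_add_le _ _)
    linarith)
  rw [← integral_sum_elim] at h2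
  simp_rw [kernelMat_form Nγ u hu] at h2
  rw [Fintype.card_sum, ← two_mul] at h2
  have hπ : (Real.pi : ℂ) ^ (2 * Fintype.card (Node Nt Nx)) ≠ 0 :=
    pow_ne_zero _ (by exact_mod_cast Real.pi_ne_zero)
  have hdet : (kernelMat Nγ u q).det ≠ 0 := fun h => by
    rw [h, mul_zero] at h2; exact hπ h2.symm
  rw [eq_comm, ← div_eq_iff hdet] at h2
  rw [← h2] at h1
  have e : ((Real.pi : ℂ) ^ (2 * Fintype.card (Node Nt Nx)))⁻¹ *
      ((Real.pi : ℂ) ^ (2 * Fintype.card (Node Nt Nx)) / (kernelMat Nγ u q).det) =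
      (kernelMat Nγ u q).det⁻¹ := by
    rw [div_eq_mul_inv, ← mul_assoc, inv_mul_cancel₀ hπ, one_mul]
  rw [e] at h1
  exact h1

end Lattice

/-! ### Evaluation of the determinant -/

theorem smul_weightedPerm {ι : Type*} [DecidableEq ι] (c : ℂ) (σ : Equiv.Perm ι) (u : ι → ℂ) :
    c • weightedPerm σ u = weightedPerm σ fun n => c * u n := by
  ext m n
  simp [weightedPerm]

/-- If `y + y⁻¹ = 2 a⁻¹` and `V'` inverts `V`, then `1 - a (V + V') / 2` is proportional to
`(1 - y V) (1 - y V')`. Here `y = exp (-X)`. -/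
theorem one_sub_half_smul_add {ι : Type*} [Fintype ι] [DecidableEq ι] (V V' : Matrix ι ι ℂ)
    (hV : V * V' = 1) {a X : ℂ} (ha : a ≠ 0) (hX : Complex.cosh X = a⁻¹) :
    1 - (a / 2) • (V + V') = (a / 2 * Complex.exp X) •
      ((1 - Complex.exp (-X) • V) * (1 - Complex.exp (-X) • V')) := by
  have h1 : a * (Complex.exp X + Complex.exp (-X)) = 2 := by
    rw [Complex.cosh] at hX
    field_simp at hX
    linear_combination hX
  have h2 : Complex.exp X * Complex.exp (-X) = 1 := by rw [← Complex.exp_add]; simp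
  rw [sub_mul, mul_sub, mul_sub, one_mul, one_mul, mul_one, Matrix.smul_mul, Matrix.mul_smul, hV]
  ext i j
  simp only [Matrix.sub_apply, Matrix.smul_apply, Matrix.add_apply, smul_eq_mul]
  linear_combination ((a / 2) * (V i j + V' i j) -
    (a / 2) * Complex.exp (-X) * (1 : Matrix ι ι ℂ) i j) * h2 - (1 : Matrix ι ι ℂ) i j * h1 / 2

/-- The factorization behind the decoupling of space and time at `λ² + τ² = 1`. Here `S'` and `V'`
are the inverses of the translations `S` and `V`. -/
theorem block_det_factorization {R : Type*} [Ring R] [Algebra ℂ R] {S S' V V' : R}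
    (hS : S * S' = 1) (hV : V * V' = 1) (hV' : V' * V = 1) (c2 : V * S' = S' * V)
    (c4 : V' * S' = S' * V') {lam tau : ℂ}
    (hdec : lam ^ 2 + tau ^ 2 = 1) :
    (1 - tau • S - (lam / 2) • (V + V')) * (1 - tau • S' - (lam / 2) • (V + V')) -
      -((lam / 2) • (V - V')) * -((lam / 2) • (V - V')) =
    (2 : ℂ) • ((1 - (tau / 2) • (S + S')) * (1 - (lam / 2) • (V + V'))) := by
  simp only [sub_mul, mul_sub, add_mul, mul_add, neg_mul, mul_neg, smul_mul_assoc, mul_smul_comm,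
    smul_smul, smul_add, smul_sub, one_mul, mul_one, hS, hV, hV', c2, c4]
  linear_combination (norm := module) hdec • (1 : R)

section Lattice

variable {Nt Nx : ℕ} [NeZero Nt] [NeZero Nx] (Nγ : ℤ)

theorem timeMat_mul_transpose (u : Node Nt Nx → ℂ) (hu : ∀ n, ‖u n‖ = 1) :
    timeMat Nγ u * (timeMat Nγ fun n => conj (u n)).transpose = 1 := by
  rw [timeMat, timeMat, weightedPerm_transpose, weightedPerm_mul, ← weightedPerm_one]
  congr 1
  · simp
  · ext n
    rw [Complex.mul_conj', hu]; simp

omit [NeZero Nt] in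
theorem shiftMat_mul_transpose :
    (shiftMat : Matrix (Node Nt Nx) (Node Nt Nx) ℂ) * shiftMat.transpose = 1 := by
  rw [shiftMat, weightedPerm_transpose, weightedPerm_mul, ← weightedPerm_one]
  congr 1
  · simp
  · simp

omit [NeZero Nx] in
theorem rightPerm_mul_nextPerm :
    (rightPerm : Equiv.Perm (Node Nt Nx)) * nextPerm Nγ = nextPerm Nγ * rightPerm := by
  ext1 n
  change right (next Nγ n) = next Nγ (right n)
  obtain ⟨t, x⟩ := n
  by_cases h : t + 1 = 0 <;> simp [right, next, h]
  ring

theorem commute_shiftMat_timeMat (u : Node Nt Nx → ℂ) (hu : ∀ n, u (right n) = u n) :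
    Commute shiftMat (timeMat Nγ u) := by
  rw [Commute, SemiconjBy, shiftMat, timeMat, weightedPerm_mul, weightedPerm_mul,
    rightPerm_mul_nextPerm]
  congr 1
  ext n
  simp [rightPerm, hu]

/-- When `λ² + τ² = 1` the determinant of the kernel splits into a factor for the spatial
direction and a factor for the time direction. -/
theorem det_kernelMat (u : Node Nt Nx → ℂ) (hu : ∀ n, ‖u n‖ = 1) (hur : ∀ n, u (right n) = u n)
    {lam tau : ℂ} (hdec : lam ^ 2 + tau ^ 2 = 1) :
    (kernelMat Nγ u (lam, tau)).det = 2 ^ Fintype.card (Node Nt Nx) *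
      (1 - (tau / 2) • (shiftMat + (shiftMat (Nt := Nt) (Nx := Nx)).transpose)).det *
      (1 - (lam / 2) • (timeMat Nγ u + (timeMat Nγ fun n => conj (u n)).transpose)).det := by
  set S : Matrix (Node Nt Nx) (Node Nt Nx) ℂ := shiftMat with hS
  set S' := S.transpose with hS'
  set V := timeMat Nγ u with hV
  set V' := (timeMat Nγ fun n => conj (u n)).transpose with hV'
  have hSS' : S * S' = 1 := shiftMat_mul_transpose
  have hS'S : S' * S = 1 := mul_eq_one_comm.mp hSS'
  have hVV' : V * V' = 1 := timeMat_mul_transpose Nγ u hu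
  have hV'V : V' * V = 1 := mul_eq_one_comm.mp hVV'
  have cSV : Commute S V := commute_shiftMat_timeMat Nγ u hur
  -- the inverse of an invertible matrix commutes with whatever the matrix commutes with
  have cS'V : Commute S' V := by
    have := congrArg (fun M => S' * M * S') cSV.eq
    simp only [← mul_assoc, hS'S, one_mul] at this
    simp only [mul_assoc, hSS', mul_one] at this
    exact this.symm
  have cS'V' : Commute S' V' := by
    have := congrArg (fun M => V' * M * V') cS'V.eq
    simp only [← mul_assoc, hV'V, one_mul] at this
    simp only [mul_assoc, hVV', mul_one] at this
    exact this.symm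
  have cVV' : Commute V V' := by rw [Commute, SemiconjBy, hVV', hV'V]
  rw [kernelMat, det_fromBlocks_of_commute]
  · rw [block_det_factorization hSS' hVV' hV'V cS'V.eq.symm cS'V'.eq.symm hdec,
      Matrix.det_smul, Matrix.det_mul, mul_assoc]
  · refine Commute.eq (Commute.neg_left ?_)
    have c1 : Commute (V - V') V := (Commute.refl V).sub_left cVV'.symm
    have c2 : Commute (V - V') V' := cVV'.sub_left (Commute.refl V')
    have c3 : Commute (V - V') S' := cS'V.symm.sub_left cS'V'.symm
    refine Commute.smul_left ?_ _
    exact (((Commute.one_right _).sub_right (c3.smul_right _))).sub_right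
      ((c1.add_right c2).smul_right _)

theorem sameCycle_addRight_one (a b : ZMod Nx) : (Equiv.addRight (1 : ZMod Nx)).SameCycle a b := by
  refine ⟨((b - a).val : ℤ), ?_⟩
  rw [zpow_natCast]
  have : ∀ k : ℕ, ((Equiv.addRight (1 : ZMod Nx)) ^ k) a = a + k := by
    intro k
    induction k with
    | zero => simp
    | succ k ih => rw [pow_succ', Equiv.Perm.mul_apply, ih]; simp [add_assoc]
  rw [this]
  simp

omit [NeZero Nt] in
/-- Translation in space is one cycle of length `Nx` on each of the `Nt` time slices. -/
theorem det_one_sub_smul_shiftMat (hNx : 2 < Nx) (y : ℂ) :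
    (1 - y • (shiftMat : Matrix (Node Nt Nx) (Node Nt Nx) ℂ)).det = (1 - y ^ Nx) ^ Nt := by
  have : Fact (1 < Nx) := ⟨by omega⟩
  have h1 : (1 - y • (shiftMat : Matrix (Node Nt Nx) (Node Nt Nx) ℂ)) =
      Matrix.kroneckerMap (· * ·) (1 : Matrix (Fin Nt) (Fin Nt) ℂ)
        (1 - weightedPerm (Equiv.addRight (1 : ZMod Nx)) fun _ => y) := by
    ext ⟨t, x⟩ ⟨t', x'⟩
    by_cases ht : t = t' <;>
      by_cases hx : x = x' + 1 <;>
        simp [shiftMat, weightedPerm, rightPerm, right, Matrix.one_apply, Prod.ext_iff, ht, hx]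
  rw [h1, Matrix.det_kronecker, Matrix.det_one, one_pow, one_mul,
    det_one_sub_weightedPerm _ sameCycle_addRight_one (by simp)]
  simp

/-- Translation in time is a single cycle through all nodes: once around the torus it moves the
first slice by `Nγ`, which generates `ℤ / Nx`. -/
theorem sameCycle_nextPerm (hNγ : IsCoprime Nγ (Nx : ℤ)) (a b : Node Nt Nx) :
    (nextPerm Nγ).SameCycle a b := by
  have hstep : ∀ n : Node Nt Nx, (nextPerm Nγ).SameCycle n (next Nγ n) := fun n =>
    ⟨1, by simp [nextPerm]⟩
  -- up one column of the lattice
  have hup : ∀ (x : ZMod Nx) (k : ℕ) (hk : k < Nt),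
      (nextPerm Nγ).SameCycle ((0, x) : Node Nt Nx) (⟨k, hk⟩, x) := by
    intro x k
    induction k with
    | zero => intro hk; exact Equiv.Perm.SameCycle.refl _ _
    | succ k ih =>
      intro hk
      refine (ih (by omega)).trans ?_
      convert hstep _ using 1
      have h1 : (⟨k, by omega⟩ : Fin Nt) + 1 = ⟨k + 1, hk⟩ := by
        apply Fin.ext
        rw [Fin.val_add_one_of_lt' (by simpa using hk)]
      have h2 : (⟨k + 1, hk⟩ : Fin Nt) ≠ 0 := by
        intro h; simpa using congrArg Fin.val h
      simp [next, h1, h2]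
  -- once around the torus
  have hround : ∀ x : ZMod Nx,
      (nextPerm Nγ).SameCycle ((0, x) : Node Nt Nx) (0, x + (Nγ : ZMod Nx)) := by
    intro x
    have hpos : 0 < Nt := Nat.pos_of_ne_zero (NeZero.ne Nt)
    refine (hup x (Nt - 1) (by omega)).trans ?_
    convert hstep _ using 1
    have h1 : (⟨Nt - 1, by omega⟩ : Fin Nt) + 1 = 0 := by
      apply Fin.ext
      rw [Fin.val_add]
      simp
      have : Nt - 1 + 1 = Nt := by omega
      simp [this]
    simp [next, h1]
  have hmul : ∀ (x : ZMod Nx) (m : ℕ), (nextPerm Nγ).SameCycle ((0, x) : Node Nt Nx)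
      (0, x + m * (Nγ : ZMod Nx)) := by
    intro x m
    induction m with
    | zero => simpa using Equiv.Perm.SameCycle.refl _ _
    | succ m ih =>
      refine ih.trans ?_
      convert hround _ using 2
      push_cast; ring
  have hzero : ∀ x y : ZMod Nx, (nextPerm Nγ).SameCycle ((0, x) : Node Nt Nx) (0, y) := by
    intro x y
    obtain ⟨v, hv⟩ := ((ZMod.coe_int_isUnit_iff_isCoprime Nγ Nx).mpr hNγ.symm).exists_left_inv
    have := hmul x ((y - x) * v).val
    rw [ZMod.natCast_zmod_val, mul_assoc, hv] at this
    simpa using this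
  obtain ⟨⟨t, ht⟩, x⟩ := a
  obtain ⟨⟨s, hs⟩, y⟩ := b
  exact (hup x t ht).symm.trans ((hzero x y).trans (hup y s hs))

theorem det_one_sub_smul_timeMat (hNx : 2 < Nx) (hNγ : IsCoprime Nγ (Nx : ℤ)) (y : ℂ)
    (u : Node Nt Nx → ℂ) :
    (1 - y • timeMat Nγ u).det = 1 - y ^ (Nt * Nx) * ∏ n, u n := by
  have : Fact (1 < Nx) := ⟨by omega⟩
  rw [timeMat, smul_weightedPerm, det_one_sub_weightedPerm _ (sameCycle_nextPerm Nγ hNγ)]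
  · rw [Finset.prod_mul_distrib, Finset.prod_const, Finset.card_univ, Fintype.card_prod,
      Fintype.card_fin, ZMod.card]
  · -- a fixed point would be the only node
    intro a ha
    have h1 := (Equiv.Perm.SameCycle.symm (sameCycle_nextPerm Nγ hNγ a (right a)))
    have h2 : right a = a := by
      obtain ⟨k, hk⟩ := sameCycle_nextPerm Nγ hNγ a (right a)
      rw [← hk]
      exact Equiv.Perm.zpow_apply_eq_self_of_apply_eq_self ha k
    simp [right, Prod.ext_iff] at h2

/-- The phases of the holonomy `diag(u, ū)` on the last time slice. -/
def slicePhase (Nt Nx : ℕ) [NeZero Nt] (u : ℂ) (n : Node Nt Nx) : ℂ := if n.1 + 1 = 0 then u else 1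

theorem prod_slicePhase (u : ℂ) : ∏ n, slicePhase Nt Nx u n = u ^ Nx := by
  have h : ∀ t : Fin Nt, ∏ x : ZMod Nx, slicePhase Nt Nx u (t, x) =
      (if t = -1 then u else 1) ^ Nx := by
    intro t
    simp [slicePhase, add_eq_zero_iff_eq_neg]
  rw [Fintype.prod_prod_type]
  simp_rw [h]
  rw [Finset.prod_pow]
  simp

end Lattice

/-! ### Analytic continuation in the couplings -/

section Continuation

/-- The complement of the zero locus of `det (1 + λ B + τ C)` is connected: it contains the
origin, and on the complex line from there to another of its points only finitely many points are
missing. -/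
theorem isConnected_det_ne_zero {ι : Type*} [Fintype ι] [DecidableEq ι] (B C : Matrix ι ι ℂ) :
    IsConnected {q : ℂ × ℂ | (1 + q.1 • B + q.2 • C).det ≠ 0} := by
  refine IsPathConnected.isConnected ⟨(0, 0), by simp, fun {q} hq => ?_⟩
  set P : Polynomial ℂ := (1 + (Polynomial.X : Polynomial ℂ) •
    (Polynomial.C : ℂ →+* Polynomial ℂ).mapMatrix (q.1 • B + q.2 • C)).det with hP
  have heval : ∀ s : ℂ, P.eval s = (1 + (s * q.1) • B + (s * q.2) • C).det := by
    intro s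
    rw [hP, ← Polynomial.coe_evalRingHom, RingHom.map_det]
    congr 1
    ext i j
    by_cases h : i = j <;> simp [h, mul_add] <;> ring
  have hP0 : P ≠ 0 := by
    intro h
    have := heval 0
    simp [h] at this
  have hfin : ({s : ℂ | P.eval s = 0}).Countable := by
    refine (P.roots.toFinset.finite_toSet.subset fun s hs => ?_).countable
    simpa [hP0] using hs
  have hpath := hfin.isPathConnected_compl_of_one_lt_rank (by simp [Complex.rank_real_complex])
  have hmaps : (fun s : ℂ => (s * q.1, s * q.2)) '' {s : ℂ | P.eval s = 0}ᶜ ⊆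
      {q : ℂ × ℂ | (1 + q.1 • B + q.2 • C).det ≠ 0} := by
    rintro _ ⟨s, hs, rfl⟩
    simpa [heval] using hs
  have himg := hpath.image (f := fun s : ℂ => (s * q.1, s * q.2)) (by fun_prop)
  refine (himg.joinedIn (0, 0) ⟨0, ?_, by simp⟩ q ⟨1, ?_, by simp⟩).mono hmaps
  · simp [heval]
  · simpa [heval] using hq

theorem analyticOnNhd_det {ι : Type*} [Fintype ι] [DecidableEq ι] (B C : Matrix ι ι ℂ)
    (U : Set (ℂ × ℂ)) :
    AnalyticOnNhd ℂ (fun q : ℂ × ℂ => (1 + q.1 • B + q.2 • C).det) U := by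
  intro q _
  simp only [Matrix.det_apply]
  refine Finset.analyticAt_fun_sum _ fun σ _ => ?_
  simp only [Units.smul_def, zsmul_eq_mul]
  refine analyticAt_const.mul (Finset.analyticAt_fun_prod _ fun i _ => ?_)
  simp only [Matrix.add_apply, Matrix.smul_apply, smul_eq_mul]
  exact (analyticAt_const.add (analyticAt_fst.mul analyticAt_const)).add
    (analyticAt_snd.mul analyticAt_const)

variable {Nt Nx : ℕ} [NeZero Nt] [NeZero Nx] {Nγ : ℤ}

/-- If for small couplings the sum over spins is `1 / D` for a determinant `D` depending affinely on
the couplings, then its continuation has the single value `1 / D` wherever `D ≠ 0`: any continuation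
`F` satisfies `F D = 1`. -/
theorem isCoherentStateValue_iff {ι : Type*} [Fintype ι] [DecidableEq ι] (B C : Matrix ι ι ℂ)
    {hh hv : Node Nt Nx → SU2}
    (hsum : ∀ᶠ p in 𝓝 ((0, 0) : ℂ × ℂ), HasSum (coherentTerm Nt Nx Nγ hh hv p)
      (1 + p.1 • B + p.2 • C).det⁻¹)
    {q : ℂ × ℂ} (hq : (1 + q.1 • B + q.2 • C).det ≠ 0) (z : ℂ) :
    IsCoherentStateValue Nt Nx Nγ hh hv q z ↔ z = (1 + q.1 • B + q.2 • C).det⁻¹ := by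
  have hcont : Continuous fun q : ℂ × ℂ => (1 + q.1 • B + q.2 • C).det := by
    refine Continuous.matrix_det ?_
    fun_prop
  constructor
  · rintro ⟨U, F, -, hU, h0, hqU, hF, hFsum, rfl⟩
    have hG : AnalyticOnNhd ℂ (fun p : ℂ × ℂ => F p * (1 + p.1 • B + p.2 • C).det - 1) U :=
      (hF.mul (analyticOnNhd_det B C U)).sub analyticOnNhd_const
    have hne : ∀ᶠ p : ℂ × ℂ in 𝓝 (0, 0), (1 + p.1 • B + p.2 • C).det ≠ 0 :=
      hcont.continuousAt.eventually_ne (by simp)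
    have hev : (fun p : ℂ × ℂ => F p * (1 + p.1 • B + p.2 • C).det - 1) =ᶠ[𝓝 (0, 0)] 0 := by
      filter_upwards [hsum, hFsum, hne] with p h1 h2 h3
      rw [h2.unique h1]
      simp [h3]
    have := hG.eqOn_zero_of_preconnected_of_eventuallyEq_zero hU.isPreconnected h0 hev hqU
    simp only [Pi.zero_apply] at this
    exact eq_inv_of_mul_eq_one_left (sub_eq_zero.mp this)
  · rintro rfl
    refine ⟨{q | (1 + q.1 • B + q.2 • C).det ≠ 0}, fun p => (1 + p.1 • B + p.2 • C).det⁻¹,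
      isOpen_ne_fun hcont continuous_const, isConnected_det_ne_zero B C, by simp, hq,
      (analyticOnNhd_det B C _).inv fun p hp => hp, hsum, rfl⟩

end Continuation

section Lattice

variable {Nt Nx : ℕ} [NeZero Nt] [NeZero Nx] (Nγ : ℤ)

omit [NeZero Nx] in
theorem kernelMat_affine (u : Node Nt Nx → ℂ) : ∃ B C, ∀ q, kernelMat Nγ u q =
    1 + q.1 • B + q.2 • C := by
  refine ⟨Matrix.fromBlocks
    (-((1 / 2 : ℂ) • (timeMat Nγ u + (timeMat Nγ fun n => conj (u n)).transpose)))
    (-((1 / 2 : ℂ) • (timeMat Nγ u - (timeMat Nγ fun n => conj (u n)).transpose)))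
    (-((1 / 2 : ℂ) • (timeMat Nγ u - (timeMat Nγ fun n => conj (u n)).transpose)))
    (-((1 / 2 : ℂ) • (timeMat Nγ u + (timeMat Nγ fun n => conj (u n)).transpose))),
    Matrix.fromBlocks (-shiftMat) 0 0 (-shiftMat.transpose), fun q => ?_⟩
  rw [kernelMat, ← Matrix.fromBlocks_one, Matrix.fromBlocks_smul, Matrix.fromBlocks_smul,
    Matrix.fromBlocks_add, Matrix.fromBlocks_add]
  congr 1 <;> module

omit [NeZero Nx] in
theorem lastSlice_diag (u : ℂ) (hu : ‖u‖ = 1) (hu' : ∀ n, ‖slicePhase Nt Nx u n‖ = 1) :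
    lastSlice Nt Nx (diagSU2 u hu) = fun n => diagSU2 (slicePhase Nt Nx u n) (hu' n) := by
  ext1 n
  apply Subtype.ext
  by_cases h : n.1 + 1 = 0
  · simp [lastSlice, slicePhase, h, diagSU2]
  · ext i j
    fin_cases i <;> fin_cases j <;> simp [lastSlice, slicePhase, h, diagSU2, quat]

omit [NeZero Nx] in
theorem norm_slicePhase (u : ℂ) (hu : ‖u‖ = 1) (n : Node Nt Nx) : ‖slicePhase Nt Nx u n‖ = 1 := by
  unfold slicePhase; split_ifs <;> simp [hu]

/-- Conjugating the holonomy amounts to a translation of all group elements at the nodes. -/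
theorem lsState_conj (T L : Node Nt Nx → ℕ) (k H : SU2) :
    lsState Nt Nx Nγ T L (fun _ => 1) (lastSlice Nt Nx (k * H * k⁻¹)) =
      lsState Nt Nx Nγ T L (fun _ => 1) (lastSlice Nt Nx H) := by
  have : (Measure.pi fun _ : Node Nt Nx => haarSU2).IsMulLeftInvariant := by
    have : haarSU2.IsMulLeftInvariant := by unfold haarSU2; infer_instance
    infer_instance
  rw [lsState, ← integral_mul_left_eq_self _ (fun _ => k), lsState]
  refine integral_congr_ae (Filter.Eventually.of_forall fun g => ?_)
  refine Finset.prod_congr rfl fun n _ => ?_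
  have h : lastSlice Nt Nx (k * H * k⁻¹) n = k * lastSlice Nt Nx H n * k⁻¹ := by
    unfold lastSlice; split_ifs <;> simp
  simp only [Pi.mul_apply, h]
  congr 3 <;> group

theorem isCoherentStateValue_conj (k H : SU2) (q : ℂ × ℂ) (z : ℂ) :
    IsCoherentStateValue Nt Nx Nγ (fun _ => 1) (lastSlice Nt Nx (k * H * k⁻¹)) q z ↔
      IsCoherentStateValue Nt Nx Nγ (fun _ => 1) (lastSlice Nt Nx H) q z := by
  have : ∀ p, coherentTerm Nt Nx Nγ (fun _ => 1) (lastSlice Nt Nx (k * H * k⁻¹)) p =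
      coherentTerm Nt Nx Nγ (fun _ => 1) (lastSlice Nt Nx H) p := by
    intro p
    ext S
    rw [coherentTerm, coherentTerm, lsState_conj]
  simp only [IsCoherentStateValue, this]

end Lattice

/-! ### Conjugacy classes and averages over `SU(2)` -/

/-- The angle `φ ∈ [0, π]` such that `H` is conjugate to `diag(exp(iφ), exp(-iφ))`. -/
def angle (H : SU2) : ℝ := Real.arccos (H.1 0 0).re

theorem continuous_angle : Continuous angle := by
  unfold angle
  refine Real.continuous_arccos.comp (Complex.continuous_re.comp ?_)
  exact (continuous_apply_apply 0 0).comp continuous_subtype_val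

theorem cos_angle (H : SU2) : Real.cos (angle H) = (H.1 0 0).re := by
  have h := (Complex.abs_re_le_norm (H.1 0 0)).trans (SU2.norm_entry_le_one H 0 0)
  rw [abs_le] at h
  exact Real.cos_arccos h.1 h.2

/-- Diagonalization: an eigenvector of `H`, read as a quaternion, points in the direction of the
conjugating element. -/
theorem exists_conj_diag (H : SU2) : ∃ k : SU2,
    H = k * diagSU2 (Complex.exp (angle H * Complex.I)) (Complex.norm_exp_ofReal_mul_I _) *
      k⁻¹ := by
  set u := Complex.exp (angle H * Complex.I) with hu
  have hu1 : ‖u‖ = 1 := Complex.norm_exp_ofReal_mul_I _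
  have huu : u * conj u = 1 := by rw [Complex.mul_conj', hu1]; simp
  set a := H.1 0 0 with ha
  set b := H.1 0 1 with hb
  have hHq : H.1 = quat (a, b) := SU2.eq_quat H
  have hab : a * conj a + b * conj b = 1 := by
    have := SU2.nsq_row H
    rw [Complex.mul_conj', Complex.mul_conj']; unfold nsq at this; exact_mod_cast this
  have hsum : u + conj u = a + conj a := by
    rw [Complex.add_conj, Complex.add_conj, ← cos_angle H, hu, Complex.exp_ofReal_mul_I_re]
  have hdet : (H.1 - u • (1 : Matrix (Fin 2) (Fin 2) ℂ)).det = 0 := by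
    rw [hHq, Matrix.det_fin_two]
    simp [quat]
    linear_combination hab - huu + u * hsum
  obtain ⟨v, hv0, hv⟩ := Matrix.exists_mulVec_eq_zero_iff.mpr hdet
  have e0 := congrFun hv 0
  have e1 := congrFun hv 1
  rw [hHq] at e0 e1
  simp [quat, Matrix.mulVec, dotProduct, Fin.sum_univ_two] at e0 e1
  have e0' := congrArg conj e0
  have e1' := congrArg conj e1
  simp at e0' e1'
  set w : ℂ × ℂ := (v 0, -conj (v 1)) with hw
  have hw0 : w ≠ 0 := by
    intro h
    apply hv0
    have h1 := congrArg Prod.fst h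
    have h2 := congrArg Prod.snd h
    simp [hw] at h1 h2
    ext i; fin_cases i <;> simp [h1, h2]
  have hs : (√(nsq w) : ℂ) ≠ 0 := by
    have h0 : nsq w ≠ 0 := fun h' => hw0 (nsq_eq_zero.mp h')
    exact_mod_cast (Real.sqrt_ne_zero (nsq_nonneg w)).mpr h0
  refine ⟨dir w, ?_⟩
  rw [eq_mul_inv_iff_mul_eq]
  apply Subtype.ext
  apply smul_right_injective _ hs
  change (√(nsq w) : ℂ) • (H.1 * (dir w).1) = (√(nsq w) : ℂ) • ((dir w).1 * quat (u, 0))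
  rw [← Matrix.mul_smul, ← Matrix.smul_mul, smul_dir, hHq]
  ext i j
  fin_cases i <;> fin_cases j <;> simp [quat, hw, Matrix.mul_apply, Fin.sum_univ_two]
  · linear_combination e0
  · linear_combination -e1'
  · linear_combination e1
  · linear_combination e0'

theorem integrable_pow_mul_exp_neg_sq (d : ℕ) :
    Integrable fun x : ℝ => x ^ d * Real.exp (-x ^ 2) := by
  have := integrable_rpow_mul_exp_neg_mul_sq one_pos (s := d)
    (by linarith [(Nat.cast_nonneg d : (0 : ℝ) ≤ d)])
  simpa [Real.rpow_natCast] using this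

/-- Integration by parts against the derivative of `-exp (-x²) / 2`. -/
theorem integral_pow_mul_exp_neg_sq_add_two (d : ℕ) :
    ∫ x : ℝ, x ^ (d + 2) * Real.exp (-x ^ 2) =
      (d + 1) / 2 * ∫ x : ℝ, x ^ d * Real.exp (-x ^ 2) := by
  have h := integral_mul_deriv_eq_deriv_mul_of_integrable
    (u := fun x : ℝ => x ^ (d + 1)) (v := fun x => -Real.exp (-x ^ 2) / 2)
    (u' := fun x => ((d : ℝ) + 1) * x ^ d) (v' := fun x => x * Real.exp (-x ^ 2))
    (fun x _ => by simpa using hasDerivAt_pow (d + 1) x)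
    (fun x _ => by
      have h1 : HasDerivAt (fun x : ℝ => -x ^ 2) (-(2 * x)) x := by
        have := (hasDerivAt_pow 2 x).neg
        simp only [Nat.cast_ofNat, Nat.add_one_sub_one, pow_one] at this
        exact this
      refine (h1.exp.neg.div_const 2).congr_deriv ?_
      ring)
    ((integrable_pow_mul_exp_neg_sq (d + 2)).congr (Filter.Eventually.of_forall fun x => by
      simp only [Pi.mul_apply]; ring))
    (((integrable_pow_mul_exp_neg_sq d).const_mul (-((d : ℝ) + 1) / 2)).congr
      (Filter.Eventually.of_forall fun x => by simp only [Pi.mul_apply]; ring))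
    (((integrable_pow_mul_exp_neg_sq (d + 1)).const_mul (-1 / 2)).congr
      (Filter.Eventually.of_forall fun x => by simp only [Pi.mul_apply]; ring))
  rw [← integral_neg] at h
  rw [← integral_const_mul]
  refine Eq.trans ?_ (h.trans ?_)
  · exact integral_congr_ae (Filter.Eventually.of_forall fun x => by simp only []; ring)
  · exact integral_congr_ae (Filter.Eventually.of_forall fun x => by simp only []; ring)

/-- The moments of half the trace of a Haar distributed element of `SU(2)`. -/
def traceMoment (d : ℕ) : ℝ := ∫ H : SU2, (H.1 0 0).re ^ d ∂haarSU2

theorem continuous_entry_re : Continuous fun H : SU2 => (H.1 0 0).re :=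
  Complex.continuous_re.comp ((continuous_apply_apply 0 0).comp continuous_subtype_val)

/-- Half the trace is the first real coordinate on the three-sphere, so its moments are those of one
Gaussian coordinate divided by the radial moments. -/
theorem traceMoment_gaussian : ∃ K : ℝ, ∀ d : ℕ,
    Real.pi ^ 2 * Real.Gamma (d / 2 + 2) * traceMoment d =
      (∫ x : ℝ, x ^ d * Real.exp (-x ^ 2)) * K := by
  refine ⟨(∫ x : ℝ, Real.exp (-x ^ 2)) * ∫ z : ℂ, Real.exp (-‖z‖ ^ 2), fun d => ?_⟩
  have hpos : 0 ≤ Real.pi ^ 2 * Real.Gamma ((d : ℝ) / 2 + 2) :=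
    mul_nonneg (sq_nonneg _) (Real.Gamma_pos_of_pos (by positivity)).le
  have h1 := congrArg (fun m => ∫ H : SU2, (H.1 0 0).re ^ d ∂m) (map_dir_radial d)
  beta_reduce at h1
  have hc : Continuous fun H : SU2 => (H.1 0 0).re ^ d := continuous_entry_re.pow d
  rw [integral_map measurable_dir.aemeasurable hc.aestronglyMeasurable,
    integral_smul_measure, ENNReal.toReal_ofReal hpos,
    integral_withDensity_eq_integral_toReal_smul
      (continuous_radialDensity d).measurable.ennreal_ofReal
      (Filter.Eventually.of_forall fun _ => ENNReal.ofReal_lt_top)] at h1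
  rw [traceMoment, ← smul_eq_mul, ← h1]
  have h2 : ∀ w : ℂ × ℂ, (ENNReal.ofReal (radialDensity d w)).toReal • ((dir w).1 0 0).re ^ d =
      (w.1.re ^ d * Real.exp (-‖w.1‖ ^ 2)) * Real.exp (-‖w.2‖ ^ 2) := by
    intro w
    have h3 : √(nsq w) * ((dir w).1 0 0).re = w.1.re := by
      have := congrArg Complex.re (congrFun₂ (smul_dir w) 0 0)
      simpa [quat] using this
    rw [ENNReal.toReal_ofReal (radialDensity_nonneg d w), radialDensity, smul_eq_mul, mul_assoc,
      ← mul_pow, h3, nsq, neg_add, Real.exp_add]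
    ring
  simp_rw [h2]
  rw [Measure.volume_eq_prod, integral_prod_mul (fun z : ℂ => z.re ^ d * Real.exp (-‖z‖ ^ 2))
    fun z : ℂ => Real.exp (-‖z‖ ^ 2), ← mul_assoc]
  congr 1
  rw [← Complex.volume_preserving_equiv_real_prod.symm.integral_comp
    Complex.measurableEquivRealProd.symm.measurableEmbedding]
  have h4 : ∀ p : ℝ × ℝ, (Complex.measurableEquivRealProd.symm p).re ^ d *
      Real.exp (-‖Complex.measurableEquivRealProd.symm p‖ ^ 2) =
      (p.1 ^ d * Real.exp (-p.1 ^ 2)) * Real.exp (-p.2 ^ 2) := by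
    intro p
    rw [← Complex.normSq_eq_norm_sq, Complex.normSq_apply]
    simp only [Complex.measurableEquivRealProd_symm_apply]
    rw [mul_assoc, ← Real.exp_add]
    congr 2
    ring
  simp_rw [h4]
  rw [Measure.volume_eq_prod, integral_prod_mul (fun x : ℝ => x ^ d * Real.exp (-x ^ 2))
    fun x : ℝ => Real.exp (-x ^ 2)]

theorem traceMoment_add_two (d : ℕ) : traceMoment (d + 2) = (d + 1) / (d + 4) * traceMoment d := by
  obtain ⟨K, hK⟩ := traceMoment_gaussian
  have h1 := hK (d + 2)
  have h2 := hK d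
  have hG : 0 < Real.Gamma ((d : ℝ) / 2 + 2) := Real.Gamma_pos_of_pos (by positivity)
  have hG2 : Real.Gamma (((d + 2 : ℕ) : ℝ) / 2 + 2) =
      (d / 2 + 2) * Real.Gamma ((d : ℝ) / 2 + 2) := by
    rw [← Real.Gamma_add_one (by positivity)]
    congr 1; push_cast; ring
  rw [hG2, integral_pow_mul_exp_neg_sq_add_two] at h1
  have h3 : (Real.pi ^ 2 * Real.Gamma ((d : ℝ) / 2 + 2)) *
      ((d / 2 + 2) * traceMoment (d + 2) - (d + 1) / 2 * traceMoment d) = 0 := by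
    linear_combination h1 - (d + 1) / 2 * h2
  have h4 : (Real.pi ^ 2 * Real.Gamma ((d : ℝ) / 2 + 2)) ≠ 0 := by positivity
  have h5 := (mul_eq_zero.mp h3).resolve_left h4
  have h6 : (d : ℝ) + 4 ≠ 0 := by positivity
  field_simp
  linear_combination 2 * h5

theorem traceMoment_zero : traceMoment 0 = 1 := by simp [traceMoment]

theorem traceMoment_one : traceMoment 1 = 0 := by
  obtain ⟨K, hK⟩ := traceMoment_gaussian
  have h1 := hK 1
  have h2 : ∫ x : ℝ, x ^ 1 * Real.exp (-x ^ 2) = 0 := by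
    have := integral_neg_eq_self (fun x : ℝ => x ^ 1 * Real.exp (-x ^ 2)) volume
    simp only [neg_sq, pow_one, neg_mul, integral_neg] at this ⊢
    linarith
  rw [h2, zero_mul] at h1
  have hG : 0 < Real.Gamma (((1 : ℕ) : ℝ) / 2 + 2) := Real.Gamma_pos_of_pos (by positivity)
  exact (mul_eq_zero.mp h1).resolve_left (by positivity)

open intervalIntegral in
theorem integral_sin_sq_mul_cos_pow (n : ℕ) :
    ∫ φ in (0 : ℝ)..Real.pi, Real.sin φ ^ 2 * Real.cos φ ^ n =
      1 / (n + 2) * ∫ φ in (0 : ℝ)..Real.pi, Real.cos φ ^ n := by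
  have h : ∀ φ : ℝ, Real.sin φ ^ 2 * Real.cos φ ^ n = Real.cos φ ^ n - Real.cos φ ^ (n + 2) := by
    intro φ; rw [Real.sin_sq]; ring
  simp_rw [h]
  rw [integral_sub (Continuous.intervalIntegrable (by fun_prop) _ _)
    (Continuous.intervalIntegrable (by fun_prop) _ _), integral_cos_pow]
  have : (n : ℝ) + 2 ≠ 0 := by positivity
  simp
  field_simp
  ring

/-- Half the trace of a Haar distributed element of `SU(2)` has the moments of the semicircle
distribution: both sides satisfy the same two-step recursion. -/
theorem traceMoment_eq (n : ℕ) : Real.pi / 2 * traceMoment n =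
    ∫ φ in (0 : ℝ)..Real.pi, Real.sin φ ^ 2 * Real.cos φ ^ n := by
  induction n using Nat.twoStepInduction with
  | zero => rw [traceMoment_zero]; simp
  | one => rw [traceMoment_one, integral_sin_sq_mul_cos_pow]; simp
  | more n ih _ =>
    rw [traceMoment_add_two, integral_sin_sq_mul_cos_pow, integral_cos_pow, mul_left_comm, ih,
      integral_sin_sq_mul_cos_pow]
    have : (n : ℝ) + 2 ≠ 0 := by positivity
    have : (n : ℝ) + 4 ≠ 0 := by positivity
    have : (n : ℝ) + 2 + 2 ≠ 0 := by positivity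
    push_cast
    simp
    field_simp
    ring

/-- The Weyl integration formula for polynomials in the trace. -/
theorem integral_polynomial_trace (P : Polynomial ℝ) :
    Real.pi / 2 * ∫ H : SU2, P.eval (H.1 0 0).re ∂haarSU2 =
      ∫ φ in (0 : ℝ)..Real.pi, Real.sin φ ^ 2 * P.eval (Real.cos φ) := by
  simp_rw [Polynomial.eval_eq_sum_range, Finset.mul_sum]
  rw [integral_finsetSum, intervalIntegral.integral_finsetSum, Finset.mul_sum]
  · refine Finset.sum_congr rfl fun i _ => ?_
    simp_rw [mul_left_comm _ (P.coeff i)]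
    rw [integral_const_mul, intervalIntegral.integral_const_mul, ← traceMoment_eq, traceMoment]
    ring
  · intro i _
    exact Continuous.intervalIntegrable (by fun_prop) _ _
  · intro i _
    have := continuous_entry_re
    exact Continuous.integrable_of_hasCompactSupport (by fun_prop)
      (HasCompactSupport.of_compactSpace _)

theorem integral_cos_nat_mul {m : ℝ} (hm : m ≠ 0) (hs : Real.sin (m * Real.pi) = 0) :
    ∫ φ in (0 : ℝ)..Real.pi, Real.cos (m * φ) = 0 := by
  rw [intervalIntegral.integral_comp_mul_left _ hm]
  simp [hs]

/-- The function `cos (m φ)` of the angle is orthogonal to the constants for `m ≥ 3`: it is half the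
difference of two nontrivial irreducible characters. -/
theorem integral_cos_angle {m : ℕ} (hm : 3 ≤ m) :
    ∫ H : SU2, Real.cos (m * angle H) ∂haarSU2 = 0 := by
  have h := integral_polynomial_trace (Polynomial.Chebyshev.T ℝ m)
  simp_rw [← cos_angle, Polynomial.Chebyshev.T_real_cos] at h
  have hm' : (3 : ℝ) ≤ m := by exact_mod_cast hm
  have e : ∀ φ : ℝ, Real.sin φ ^ 2 * Real.cos (((m : ℤ) : ℝ) * φ) =
      1 / 2 * Real.cos (m * φ) - 1 / 4 * (Real.cos ((m + 2) * φ) + Real.cos ((m - 2) * φ)) := by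
    intro φ
    rw [add_mul, sub_mul, Real.cos_add, Real.cos_sub, Real.cos_two_mul, Real.cos_sq']
    push_cast
    ring
  simp_rw [e] at h
  rw [intervalIntegral.integral_sub (Continuous.intervalIntegrable (by fun_prop) _ _)
    (Continuous.intervalIntegrable (by fun_prop) _ _), intervalIntegral.integral_const_mul,
    intervalIntegral.integral_const_mul, intervalIntegral.integral_add
    (Continuous.intervalIntegrable (by fun_prop) _ _)
    (Continuous.intervalIntegrable (by fun_prop) _ _),
    integral_cos_nat_mul (by linarith) (Real.sin_nat_mul_pi m),
    integral_cos_nat_mul (by linarith) (by exact_mod_cast Real.sin_nat_mul_pi (m + 2)),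
    integral_cos_nat_mul (by linarith) (by
      have := Real.sin_int_mul_pi ((m : ℤ) - 2)
      push_cast at this
      exact this)] at h
  have hpi := Real.pi_pos
  have h' : Real.pi / 2 * ∫ H : SU2, Real.cos (m * angle H) ∂haarSU2 = 0 := by
    simpa using h
  exact (mul_eq_zero.mp h').resolve_left (by positivity)

theorem cosh_sub_cos_eq (Y θ : ℂ) : Complex.cosh Y - Complex.cos θ =
    (1 - Complex.exp (-Y) * Complex.exp (θ * Complex.I)) *
      (1 - Complex.exp (-Y) * (Complex.exp (θ * Complex.I))⁻¹) / (2 * Complex.exp (-Y)) := by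
  rw [Complex.cosh, Complex.cos, Complex.exp_neg, neg_mul, Complex.exp_neg]
  have h1 := Complex.exp_ne_zero Y
  have h2 := Complex.exp_ne_zero (θ * Complex.I)
  field_simp
  ring

theorem one_sub_exp_ne_zero {Y : ℂ} (hY : 0 < Y.re) {z : ℂ} (hz : ‖z‖ = 1) :
    1 - Complex.exp (-Y) * z ≠ 0 := by
  intro h
  have h1 : ‖Complex.exp (-Y) * z‖ < 1 := by
    rw [norm_mul, hz, mul_one, Complex.norm_exp]; simpa using hY
  rw [← sub_eq_zero.mp h] at h1
  simp at h1

theorem cosh_sub_cos_ne_zero {Y : ℂ} (hY : 0 < Y.re) (θ : ℝ) :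
    Complex.cosh Y - Complex.cos θ ≠ 0 := by
  rw [cosh_sub_cos_eq]
  have hz := Complex.norm_exp_ofReal_mul_I θ
  exact div_ne_zero (mul_ne_zero (one_sub_exp_ne_zero hY hz)
    (one_sub_exp_ne_zero hY (by rw [norm_inv, hz, inv_one])))
    (mul_ne_zero two_ne_zero (Complex.exp_ne_zero _))

/-- The Haar average of the Poisson kernel `1 / (ch Y - cos (N φ))`. In its expansion in
`exp (-m Y) cos (m N φ)` only the constant term survives, because `N > 2`. -/
theorem integral_cosh_sub_cos_angle {Y : ℂ} (hY : 0 < Y.re) {N : ℕ} (hN : 2 < N) :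
    ∫ H : SU2, (Complex.cosh Y - Complex.cos (N * angle H))⁻¹ ∂haarSU2 = (Complex.sinh Y)⁻¹ := by
  set r := Complex.exp (-Y) with hr
  have hr1 : ‖r‖ < 1 := by rw [hr, Complex.norm_exp]; simpa using hY
  have hr0 : r ≠ 0 := Complex.exp_ne_zero _
  have hsinh : Complex.sinh Y = (r⁻¹ - r) / 2 := by
    rw [Complex.sinh, hr, Complex.exp_neg, inv_inv]
  have hcosh : Complex.cosh Y = (r⁻¹ + r) / 2 := by
    rw [Complex.cosh, hr, Complex.exp_neg, inv_inv]
  have hr2 : 1 - r ^ 2 ≠ 0 := by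
    intro h
    have : ‖r ^ 2‖ = 1 := by rw [← sub_eq_zero.mp h]; simp
    rw [norm_pow] at this
    nlinarith [norm_nonneg r]
  have hsinh0 : Complex.sinh Y ≠ 0 := by
    rw [hsinh, show r⁻¹ - r = (1 - r ^ 2) / r by field_simp]
    exact div_ne_zero (div_ne_zero hr2 hr0) two_ne_zero
  -- the Poisson kernel as a Fourier series; the constant term is counted twice, hence the `+ 1`
  have hseries : ∀ θ : ℝ, HasSum (fun m : ℕ => r ^ m * (2 * (Real.cos (m * θ) : ℂ)))
      (Complex.sinh Y * (Complex.cosh Y - Complex.cos θ)⁻¹ + 1) := by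
    intro θ
    set z := Complex.exp (θ * Complex.I) with hz
    have hz1 : ‖z‖ = 1 := Complex.norm_exp_ofReal_mul_I θ
    have hz0 : z ≠ 0 := Complex.exp_ne_zero _
    have n1 : ‖r * z‖ < 1 := by rw [norm_mul, hz1, mul_one]; exact hr1
    have n2 : ‖r * z⁻¹‖ < 1 := by rw [norm_mul, norm_inv, hz1, inv_one, mul_one]; exact hr1
    have d1 : 1 - r * z ≠ 0 := one_sub_exp_ne_zero hY hz1
    have d2 : 1 - r * z⁻¹ ≠ 0 := one_sub_exp_ne_zero hY (by rw [norm_inv, hz1, inv_one])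
    have hs := (hasSum_geometric_of_norm_lt_one n1).add (hasSum_geometric_of_norm_lt_one n2)
    have e1 : (1 - r * z)⁻¹ + (1 - r * z⁻¹)⁻¹ =
        Complex.sinh Y * (Complex.cosh Y - Complex.cos θ)⁻¹ + 1 := by
      have d3 : 1 - r * z⁻¹ = (z - r) / z := by field_simp
      rw [cosh_sub_cos_eq, ← hr, ← hz, hsinh]
      rw [d3] at d2 ⊢
      have d4 : z - r ≠ 0 := fun h => d2 (by rw [h, zero_div])
      field_simp
      ring
    have e2 : (fun m : ℕ => (r * z) ^ m + (r * z⁻¹) ^ m) =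
        fun m : ℕ => r ^ m * (2 * (Real.cos (m * θ) : ℂ)) := by
      ext m
      rw [mul_pow, mul_pow, ← mul_add, Complex.ofReal_cos, Complex.two_cos, hz, ← Complex.exp_neg,
        ← Complex.exp_nat_mul (θ * Complex.I) m, ← Complex.exp_nat_mul (-(θ * Complex.I)) m]
      push_cast
      ring_nf
    rw [e1, e2] at hs
    exact hs
  have hcont := continuous_angle
  have hterm : ∀ m : ℕ, ∫ H : SU2, r ^ m * (2 * (Real.cos (m * (N * angle H)) : ℂ)) ∂haarSU2 =
      if m = 0 then 2 else 0 := by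
    intro m
    rw [integral_const_mul, integral_const_mul, integral_complex_ofReal]
    split_ifs with h
    · simp [h]
    · have h3 : 3 ≤ m * N := by nlinarith [Nat.pos_of_ne_zero h]
      have := integral_cos_angle h3
      push_cast at this
      simp_rw [mul_assoc] at this
      rw [this]
      simp
  have hint : ∀ m : ℕ, Integrable (fun H : SU2 => r ^ m * (2 * (Real.cos (m * (N * angle H)) : ℂ)))
      haarSU2 := by
    intro m
    exact Continuous.integrable_of_hasCompactSupport (by fun_prop)
      (HasCompactSupport.of_compactSpace _)
  have hnorm : Summable fun m : ℕ =>
      ∫ H : SU2, ‖r ^ m * (2 * (Real.cos (m * (N * angle H)) : ℂ))‖ ∂haarSU2 := by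
    refine Summable.of_nonneg_of_le (fun m => integral_nonneg fun H => norm_nonneg _) (fun m => ?_)
      ((summable_geometric_of_lt_one (norm_nonneg r) hr1).mul_right 2)
    calc _ ≤ ∫ H : SU2, ‖r‖ ^ m * 2 ∂haarSU2 := by
          refine integral_mono (hint m).norm (integrable_const _) fun H => ?_
          simp only [norm_mul, norm_pow, Complex.norm_real, Real.norm_eq_abs]
          have := Real.abs_cos_le_one (m * (N * angle H))
          simp only [Complex.norm_ofNat]
          have h2 := pow_nonneg (norm_nonneg r) m
          nlinarith
      _ = _ := by simp
  have h1 := hasSum_integral_of_summable_integral_norm hint hnorm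
  simp_rw [hterm] at h1
  have h2 := h1.unique (hasSum_ite_eq 0 2)
  have h3 : ∀ H : SU2, ∑' m : ℕ, r ^ m * (2 * (Real.cos (m * (N * angle H)) : ℂ)) =
      Complex.sinh Y * (Complex.cosh Y - Complex.cos (N * angle H))⁻¹ + 1 := by
    intro H
    rw [(hseries (N * angle H)).tsum_eq]
    push_cast
    rfl
  simp_rw [h3] at h2
  have hne : ∀ H : SU2, Complex.cosh Y - Complex.cos (N * angle H) ≠ 0 := fun H => by
    have := cosh_sub_cos_ne_zero hY (N * angle H)
    push_cast at this
    exact this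
  rw [integral_add, integral_const_mul] at h2
  · simp at h2
    exact eq_inv_of_mul_eq_one_left (by linear_combination h2)
  · refine Integrable.const_mul (Continuous.integrable_of_hasCompactSupport
      (Continuous.inv₀ (by fun_prop) hne) (HasCompactSupport.of_compactSpace _)) _
  · exact integrable_const _

/-! ### The coherent state on a flat connection -/

section Lattice

variable {Nt Nx : ℕ} [NeZero Nt] [NeZero Nx] (Nγ : ℤ)

/-- The determinant of the kernel for the holonomy `diag (exp (i φ), exp (-i φ))`. The twist has
dropped out. -/
theorem det_kernelMat_closed (hNx : 2 < Nx) (hNγ : IsCoprime Nγ (Nx : ℤ)) {lam tau : ℂ}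
    (hdec : lam ^ 2 + tau ^ 2 = 1) (hlam0 : lam ≠ 0) (htau0 : tau ≠ 0) {Xlam Xtau : ℂ}
    (hXlam : Complex.cosh Xlam = lam⁻¹) (hXtau : Complex.cosh Xtau = tau⁻¹) (φ : ℝ) :
    (kernelMat Nγ (slicePhase Nt Nx (Complex.exp (φ * Complex.I))) (lam, tau)).det =
      (lam * tau) ^ (Nt * Nx) * ((2 : ℂ) ^ ((Nt : ℤ) * ((Nx : ℤ) - 2) - 1))⁻¹ *
        Complex.sinh (Nx * Xtau / 2) ^ (2 * Nt) *
        (Complex.cosh (Nx * Nt * Xlam) - Complex.cos (Nx * φ)) := by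
  set u := Complex.exp (φ * Complex.I) with hu
  have hu1 : ‖u‖ = 1 := Complex.norm_exp_ofReal_mul_I φ
  have huc : conj u = u⁻¹ := by
    refine eq_inv_of_mul_eq_one_left ?_
    rw [Complex.conj_mul', hu1]; simp
  have hus := norm_slicePhase (Nt := Nt) (Nx := Nx) u hu1
  have hconj : (fun n : Node Nt Nx => conj (slicePhase Nt Nx u n)) = slicePhase Nt Nx u⁻¹ := by
    ext1 n
    unfold slicePhase
    split_ifs <;> simp [huc]
  have htr : ∀ (y : ℂ) (M : Matrix (Node Nt Nx) (Node Nt Nx) ℂ),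
      (1 - y • M.transpose).det = (1 - y • M).det := by
    intro y M
    rw [← Matrix.det_transpose]
    simp
  have hcard : Fintype.card (Node Nt Nx) = Nt * Nx := by
    rw [Fintype.card_prod, Fintype.card_fin, ZMod.card]
  rw [det_kernelMat Nγ _ hus (fun n => rfl) hdec,
    one_sub_half_smul_add _ _ shiftMat_mul_transpose htau0 hXtau,
    one_sub_half_smul_add _ _ (timeMat_mul_transpose Nγ _ hus) hlam0 hXlam,
    Matrix.det_smul, Matrix.det_smul, Matrix.det_mul, Matrix.det_mul, htr, htr,
    det_one_sub_smul_shiftMat hNx, det_one_sub_smul_timeMat Nγ hNx hNγ,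
    det_one_sub_smul_timeMat Nγ hNx hNγ, hconj, prod_slicePhase, prod_slicePhase, hcard]
  have ht : Complex.exp Xtau ^ (Nt * Nx) * ((1 - Complex.exp (-Xtau) ^ Nx) ^ Nt *
      (1 - Complex.exp (-Xtau) ^ Nx) ^ Nt) = 2 ^ (2 * Nt) *
        Complex.sinh (Nx * Xtau / 2) ^ (2 * Nt) := by
    rw [mul_comm Nt Nx, pow_mul, ← mul_pow, ← mul_pow, pow_mul, pow_mul, ← mul_pow]
    congr 1
    set a := Complex.exp (Nx * Xtau / 2) with ha
    have ha0 : a ≠ 0 := Complex.exp_ne_zero _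
    have e1 : Complex.exp Xtau ^ Nx = a ^ 2 := by
      rw [ha, ← Complex.exp_nat_mul, ← Complex.exp_nat_mul]; congr 1; push_cast; ring
    have e2 : Complex.sinh (Nx * Xtau / 2) = (a - a⁻¹) / 2 := by
      rw [Complex.sinh, ha, Complex.exp_neg]
    rw [Complex.exp_neg, inv_pow, e1, e2]
    field_simp
  have hl : Complex.exp Xlam ^ (Nt * Nx) * ((1 - Complex.exp (-Xlam) ^ (Nt * Nx) * u ^ Nx) *
      (1 - Complex.exp (-Xlam) ^ (Nt * Nx) * u⁻¹ ^ Nx)) =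
        2 * (Complex.cosh (Nx * Nt * Xlam) - Complex.cos (Nx * φ)) := by
    have e1 : Complex.exp Xlam ^ (Nt * Nx) = Complex.exp (Nx * Nt * Xlam) := by
      rw [← Complex.exp_nat_mul]; congr 1; push_cast; ring
    have e2 : u ^ Nx = Complex.exp (Nx * φ * Complex.I) := by
      rw [hu, ← Complex.exp_nat_mul]; congr 1; ring
    rw [Complex.exp_neg, inv_pow, inv_pow, e1, e2, Complex.cosh, Complex.cos, Complex.exp_neg,
      neg_mul, Complex.exp_neg]
    have d1 := Complex.exp_ne_zero (Nx * Nt * Xlam)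
    have d2 := Complex.exp_ne_zero (Nx * φ * Complex.I)
    field_simp
    ring
  have h2 : ((2 : ℂ) ^ ((Nt : ℤ) * ((Nx : ℤ) - 2) - 1))⁻¹ * 2 ^ (Nt * Nx) = 2 ^ (2 * Nt) * 2 := by
    rw [← zpow_neg, ← zpow_natCast, ← zpow_add₀ two_ne_zero, ← pow_succ, ← zpow_natCast]
    congr 1
    push_cast
    ring
  rw [mul_pow, mul_pow, div_pow, div_pow, mul_assoc (tau ^ (Nt * Nx) / 2 ^ (Nt * Nx)),
    mul_assoc (lam ^ (Nt * Nx) / 2 ^ (Nt * Nx)), ht, hl]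
  have h20 : (2 : ℂ) ^ (Nt * Nx) ≠ 0 := pow_ne_zero _ two_ne_zero
  rw [← div_eq_iff_mul_eq h20] at h2
  rw [← h2, mul_pow]
  field_simp

/-- The coherent state on the flat connection with holonomy `H`, in closed form. -/
theorem isCoherentStateValue_lastSlice (hNx : 2 < Nx) (hNγ : IsCoprime Nγ (Nx : ℤ)) {lam tau : ℂ}
    (hdec : lam ^ 2 + tau ^ 2 = 1) (hlam0 : lam ≠ 0) (htau0 : tau ≠ 0) {Xlam Xtau : ℂ}
    (hXlam : Complex.cosh Xlam = lam⁻¹) (hXtau : Complex.cosh Xtau = tau⁻¹)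
    (hre : 0 < Xlam.re) (hsinh : Complex.sinh (Nx * Xtau / 2) ≠ 0) (H : SU2) (z : ℂ) :
    IsCoherentStateValue Nt Nx Nγ (fun _ => 1) (lastSlice Nt Nx H) (lam, tau) z ↔
      z = (2 : ℂ) ^ ((Nt : ℤ) * ((Nx : ℤ) - 2) - 1) / (lam * tau) ^ (Nt * Nx) *
        (1 / Complex.sinh (Nx * Xtau / 2) ^ (2 * Nt)) *
        (Complex.cosh (Nx * Nt * Xlam) - Complex.cos (Nx * angle H))⁻¹ := by
  obtain ⟨k, hk⟩ := exists_conj_diag H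
  set u := Complex.exp (angle H * Complex.I) with hu
  have hu1 : ‖u‖ = 1 := Complex.norm_exp_ofReal_mul_I _
  obtain ⟨B, C, hBC⟩ := kernelMat_affine Nγ (slicePhase Nt Nx u)
  have hdet := det_kernelMat_closed (Nt := Nt) Nγ hNx hNγ hdec hlam0 htau0 hXlam hXtau (angle H)
  have hne : (kernelMat Nγ (slicePhase Nt Nx u) (lam, tau)).det ≠ 0 := by
    rw [hdet]
    have hY : 0 < (Nx * Nt * Xlam : ℂ).re := by
      have h1 : (0 : ℝ) < Nx := by exact_mod_cast Nat.pos_of_ne_zero (NeZero.ne Nx)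
      have h2 : (0 : ℝ) < Nt := by exact_mod_cast Nat.pos_of_ne_zero (NeZero.ne Nt)
      have : (Nx * Nt * Xlam : ℂ) = ((Nx * Nt : ℝ) : ℂ) * Xlam := by push_cast; ring
      rw [this, Complex.re_ofReal_mul]
      positivity
    have := cosh_sub_cos_ne_zero hY (Nx * angle H)
    push_cast at this
    refine mul_ne_zero (mul_ne_zero (mul_ne_zero ?_ ?_) ?_) this
    · exact pow_ne_zero _ (mul_ne_zero hlam0 htau0)
    · exact inv_ne_zero (zpow_ne_zero _ two_ne_zero)
    · exact pow_ne_zero _ hsinh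
  rw [hk, isCoherentStateValue_conj, lastSlice_diag u hu1 (norm_slicePhase u hu1)]
  rw [← hk]
  have hsmall : ∀ᶠ p in 𝓝 ((0, 0) : ℂ × ℂ), ‖p.2‖ + 2 * ‖p.1‖ < 1 := by
    have hc : Continuous fun p : ℂ × ℂ => ‖p.2‖ + 2 * ‖p.1‖ := by fun_prop
    exact hc.continuousAt.eventually_lt continuousAt_const (by simp)
  have hmain := isCoherentStateValue_iff (Nγ := Nγ) B C
    (hsmall.mono fun p hp => by
      rw [← hBC]
      exact hasSum_coherentTerm_diag Nγ _ (norm_slicePhase u hu1) hp) (q := (lam, tau))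
    (by rw [← hBC]; exact hne) z
  rw [hmain, ← hBC, hdet]
  simp only [mul_inv, inv_inv, div_eq_mul_inv, one_mul]
  rw [mul_comm ((2 : ℂ) ^ _)]

end Lattice

/-! ### The product formula and the couplings -/

open Finset in
/-- The product of `2 (ch a - cos (k γ + i a))` over the nonzero residues `k`, for
`γ = 2 π M / N`. With `ω = e ^ (i γ)` each factor splits as `(1 - ω⁻ᵏ) (eᵃ - ωᵏ e⁻ᵃ)`, and `ω` is
a primitive `N`-th root of unity. -/
theorem sinh_mul_prod_cosh_sub_cos {N : ℕ} (hN : N ≠ 0) {M : ℤ} (hM : IsCoprime M (N : ℤ))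
    (a : ℂ) :
    Complex.sinh a * ∏ k ∈ Ico 1 N, (2 * (Complex.cosh a -
        Complex.cos (k * (2 * (Real.pi : ℂ) * M / N) + Complex.I * a))) =
      N * Complex.sinh (N * a) := by
  have hω := Complex.isPrimitiveRoot_exp_of_isCoprime M N hN hM
  set ω := Complex.exp (2 * Real.pi * Complex.I * (M / N)) with hωdef
  have hω0 : ω ≠ 0 := Complex.exp_ne_zero _
  set x := Complex.exp a with hx
  have hx0 : x ≠ 0 := Complex.exp_ne_zero _
  have hfac (k : ℕ) : 2 * (Complex.cosh a -
      Complex.cos (k * (2 * (Real.pi : ℂ) * M / N) + Complex.I * a)) =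
        (1 - ω⁻¹ ^ k) * (x - ω ^ k * x⁻¹) := by
    have e1 : Complex.exp ((k * (2 * (Real.pi : ℂ) * M / N) + Complex.I * a) * Complex.I) =
        ω ^ k * x⁻¹ := by
      rw [hωdef, hx, ← Complex.exp_nat_mul, ← Complex.exp_neg, ← Complex.exp_add]
      congr 1
      linear_combination a * Complex.I_sq
    rw [Complex.cosh, Complex.cos, neg_mul, Complex.exp_neg, Complex.exp_neg, e1, ← hx]
    have := pow_ne_zero k hω0
    rw [inv_pow]
    field_simp
    ring
  obtain ⟨m, rfl⟩ := Nat.exists_eq_succ_of_ne_zero hN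
  have hA : ∏ k ∈ Ico 1 (m + 1), (1 - ω⁻¹ ^ k) = ((m + 1 : ℕ) : ℂ) := by
    rw [prod_Ico_eq_prod_range, Nat.add_sub_cancel]
    have := IsPrimitiveRoot.prod_one_sub_pow_eq_order hω.inv
    push_cast
    rw [← this]
    exact prod_congr rfl fun k _ => by rw [add_comm]
  have hB : ∏ k ∈ range (m + 1), (x - ω ^ k * x⁻¹) = x ^ (m + 1) - x⁻¹ ^ (m + 1) := by
    have h := congrArg (Polynomial.eval x)
      (X_pow_sub_C_eq_prod hω (Nat.succ_pos m) (rfl : x⁻¹ ^ (m + 1) = _))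
    simpa [Polynomial.eval_prod] using h.symm
  rw [prod_range_eq_mul_Ico _ (Nat.succ_pos m)] at hB
  simp only [hfac, prod_mul_distrib]
  rw [hA, Complex.sinh, Complex.sinh, Complex.exp_neg, Complex.exp_neg, Complex.exp_nat_mul,
    ← inv_pow, ← hx, ← hB]
  ring

/-- The inverse hyperbolic cosine of `a⁻¹` has positive real part unless `a` is real of absolute
value at least one. -/
theorem IsArcosh.re_pos {X a : ℂ} (hX : IsArcosh X a⁻¹) (ha0 : a ≠ 0)
    (ha : ∀ r : ℝ, a = (r : ℂ) → |r| < 1) : 0 < X.re := by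
  refine lt_of_le_of_ne hX.2 fun h0 => ?_
  have hXI : X = (X.im : ℂ) * Complex.I := by
    conv_lhs => rw [← Complex.re_add_im X, ← h0]
    simp
  have hc : a⁻¹ = ((Real.cos X.im : ℝ) : ℂ) := by
    rw [← hX.1, Complex.ofReal_cos, ← Complex.cosh_mul_I, ← hXI]
  have hcos : Real.cos X.im ≠ 0 := by
    intro h
    rw [h] at hc
    exact inv_ne_zero ha0 (by simpa using hc)
  have h1 := ha (Real.cos X.im)⁻¹ (by rw [Complex.ofReal_inv, ← hc, inv_inv])
  rw [abs_inv] at h1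
  exact absurd (Real.abs_cos_le_one X.im)
    (not_le.mpr ((inv_lt_one₀ (abs_pos.mpr hcos)).mp h1))

/-- If `sh (N X / 2) = 0` then `ch X = cos (2 π k / N)` for some integer `k`, which the assumption
on `a = 1 / ch X` excludes. -/
theorem sinh_half_mul_ne_zero {N : ℕ} (hN : N ≠ 0) {X a : ℂ} (ha0 : a ≠ 0)
    (hX : Complex.cosh X = a⁻¹)
    (ha : ∀ k : ℕ, a * Complex.cos (2 * (Real.pi : ℂ) * k / N) ≠ 1) :
    Complex.sinh (N * X / 2) ≠ 0 := by
  intro h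
  have h1 : Complex.sin (N * X / 2 * Complex.I) = 0 := by rw [Complex.sin_mul_I, h, zero_mul]
  obtain ⟨k, hk⟩ := Complex.sin_eq_zero_iff.mp h1
  have hN' : (N : ℂ) ≠ 0 := Nat.cast_ne_zero.mpr hN
  have hXI : X * Complex.I = 2 * (Real.pi : ℂ) * k / N := by
    field_simp
    linear_combination 2 * hk
  have hcos : Complex.cos (2 * (Real.pi : ℂ) * k / N) = a⁻¹ := by
    rw [← hX, ← Complex.cos_mul_I, hXI]
  obtain ⟨m, rfl | rfl⟩ := k.eq_nat_or_neg
  · exact ha m (by rw [← Int.cast_natCast (R := ℂ) m, hcos, mul_inv_cancel₀ ha0])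
  · refine ha m ?_
    rw [Int.cast_neg, Int.cast_natCast, mul_neg, neg_div, Complex.cos_neg] at hcos
    rw [hcos, mul_inv_cancel₀ ha0]

section

variable {Nt Nx : ℕ} [NeZero Nt] [NeZero Nx] {Nγ : ℤ}

/-- The wave-function is defined by choice among its values, so a unique value determines it. -/
theorem coherentState_eq_of_forall {hh hv : Node Nt Nx → SU2} {q : ℂ × ℂ} {c : ℂ}
    (h : ∀ z, IsCoherentStateValue Nt Nx Nγ hh hv q z ↔ z = c) :
    coherentState Nt Nx Nγ q hh hv = c :=
  (h _).mp (Classical.epsilon_spec ⟨c, (h c).mpr rfl⟩)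

end

end PonzanoRegge

end

open PonzanoRegge in
theorem mainTheorem1 (Nt Nx : ℕ) [NeZero Nt] [NeZero Nx] (hNx : 2 < Nx)
    (Nγ : ℤ) (hNγ : IsCoprime Nγ (Nx : ℤ))
    (lam tau : ℂ) (hdec : lam ^ 2 + tau ^ 2 = 1)
    (hlam0 : lam ≠ 0) (hlam : ∀ r : ℝ, lam = (r : ℂ) → |r| < 1)
    (htau : ∀ k : ℕ, tau * Complex.cos (2 * (Real.pi : ℂ) * k / Nx) ≠ 1)
    (Xlam Xtau : ℂ) (hXlam : PonzanoRegge.IsArcosh Xlam lam⁻¹)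
    (hXtau : PonzanoRegge.IsArcosh Xtau tau⁻¹) :
    (∀ H : PonzanoRegge.SU2, ∃! z : ℂ, PonzanoRegge.IsCoherentStateValue Nt Nx Nγ
      (fun _ => 1) (PonzanoRegge.lastSlice Nt Nx H) (lam, tau) z) ∧
    Integrable (fun H : PonzanoRegge.SU2 => PonzanoRegge.coherentState Nt Nx Nγ (lam, tau)
      (fun _ => 1) (PonzanoRegge.lastSlice Nt Nx H)) PonzanoRegge.haarSU2 ∧
    PonzanoRegge.partitionFunction Nt Nx Nγ lam tau =
      (2 : ℂ) ^ ((Nt : ℤ) * ((Nx : ℤ) - 2) - 1) / (lam * tau) ^ (Nt * Nx) *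
        (1 / Complex.sinh (Nx * Xtau / 2) ^ (2 * Nt)) *
        (Nx / Complex.sinh (Nt * Xlam)) *
        ∏ k ∈ Finset.Ico 1 Nx,
          1 / (2 * (Complex.cosh (Nt * Xlam) -
            Complex.cos (k * (2 * (Real.pi : ℂ) * Nγ / Nx) + Complex.I * (Nt * Xlam)))) ∧
    PonzanoRegge.partitionFunction Nt Nx Nγ lam tau =
      (2 : ℂ) ^ ((Nt : ℤ) * ((Nx : ℤ) - 2) - 1) / (lam * tau) ^ (Nt * Nx) *
        (1 / Complex.sinh (Nx * Xtau / 2) ^ (2 * Nt)) *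
        (1 / Complex.sinh (Nx * Nt * Xlam)) ∧
    ∀ Nγ' : ℤ, IsCoprime Nγ' (Nx : ℤ) →
      PonzanoRegge.partitionFunction Nt Nx Nγ' lam tau =
        PonzanoRegge.partitionFunction Nt Nx Nγ lam tau := by
  -- `τ = 0` would force `λ = ± 1`, which is degenerate
  have htau0 : tau ≠ 0 := by
    rintro rfl
    have h : lam = 1 ∨ lam = -1 :=
      eq_or_eq_neg_of_sq_eq_sq _ _ (by simpa using hdec : lam ^ 2 = 1 ^ 2)
    obtain h | h := h
    · simpa using hlam 1 (by simp [h])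
    · simpa using hlam (-1) (by simp [h])
  have hre := hXlam.re_pos hlam0 hlam
  have hsinh := sinh_half_mul_ne_zero (NeZero.ne Nx) htau0 hXtau.1 htau
  have hval (M : ℤ) (hM : IsCoprime M (Nx : ℤ)) (H : SU2) (z : ℂ) :=
    isCoherentStateValue_lastSlice (Nt := Nt) M hNx hM hdec hlam0 htau0 hXlam.1 hXtau.1 hre
      hsinh H z
  have hpos (N : ℕ) [NeZero N] {X : ℂ} (hX : 0 < X.re) : 0 < ((N : ℂ) * X).re := by
    have : (0 : ℝ) < N := Nat.cast_pos.mpr (Nat.pos_of_ne_zero (NeZero.ne N))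
    rw [← Complex.ofReal_natCast, Complex.re_ofReal_mul]
    positivity
  have hY : 0 < (Nx * Nt * Xlam : ℂ).re := by
    rw [mul_assoc]
    exact hpos Nx (hpos Nt hre)
  set C := (2 : ℂ) ^ ((Nt : ℤ) * ((Nx : ℤ) - 2) - 1) / (lam * tau) ^ (Nt * Nx) *
    (1 / Complex.sinh (Nx * Xtau / 2) ^ (2 * Nt)) with hC
  have hstate (M : ℤ) (hM : IsCoprime M (Nx : ℤ)) :
      (fun H : SU2 => coherentState Nt Nx M (lam, tau) (fun _ => 1) (lastSlice Nt Nx H)) =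
        fun H => C * (Complex.cosh (Nx * Nt * Xlam) - Complex.cos (Nx * angle H))⁻¹ :=
    funext fun H => coherentState_eq_of_forall (hval M hM H)
  have hZ (M : ℤ) (hM : IsCoprime M (Nx : ℤ)) :
      partitionFunction Nt Nx M lam tau = C * (1 / Complex.sinh (Nx * Nt * Xlam)) := by
    rw [partitionFunction, hstate M hM, integral_const_mul, integral_cosh_sub_cos_angle hY hNx,
      one_div]
  refine ⟨fun H => ⟨_, (hval Nγ hNγ H _).mpr rfl, fun z hz => (hval Nγ hNγ H z).mp hz⟩, ?_, ?_,
    hZ Nγ hNγ, fun M hM => (hZ M hM).trans (hZ Nγ hNγ).symm⟩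
  · rw [hstate Nγ hNγ]
    have hne (H : SU2) :
        Complex.cosh (Nx * Nt * Xlam) - Complex.cos (Nx * (angle H : ℂ)) ≠ 0 := by
      have := cosh_sub_cos_ne_zero hY (Nx * angle H)
      push_cast at this
      exact this
    have hcont := continuous_angle
    have hinv : Continuous fun H : SU2 =>
        (Complex.cosh (Nx * Nt * Xlam) - Complex.cos (Nx * (angle H : ℂ)))⁻¹ :=
      Continuous.inv₀ (by fun_prop) hne
    exact (continuous_const.mul hinv).integrable_of_hasCompactSupport
      (HasCompactSupport.of_compactSpace _)
  · have hprod := sinh_mul_prod_cosh_sub_cos (NeZero.ne Nx) hNγ (Nt * Xlam)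
    have hY0 : Complex.sinh (Nx * (Nt * Xlam)) ≠ 0 := by
      have hpos' := hpos Nx (hpos Nt hre)
      intro h
      have hsq := Complex.cosh_sq (Nx * (Nt * Xlam))
      rw [h] at hsq
      obtain h1 | h1 := eq_or_eq_neg_of_sq_eq_sq _ _
        (by simpa using hsq : Complex.cosh (Nx * (Nt * Xlam)) ^ 2 = 1 ^ 2)
      · exact cosh_sub_cos_ne_zero hpos' 0 (by simp [h1])
      · exact cosh_sub_cos_ne_zero hpos' Real.pi (by simp [h1])
    have hN0 : (Nx : ℂ) ≠ 0 := Nat.cast_ne_zero.mpr (NeZero.ne Nx)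
    have hne := mul_ne_zero hN0 hY0
    rw [← hprod] at hne
    have hS := left_ne_zero_of_mul hne
    have hP := right_ne_zero_of_mul hne
    rw [hZ Nγ hNγ, mul_assoc C]
    simp only [one_div, Finset.prod_inv_distrib]
    congr 1
    rw [mul_assoc (Nx : ℂ), ← div_eq_mul_inv, div_div,
      eq_div_iff (mul_ne_zero hS hP), hprod, mul_comm, mul_assoc, mul_inv_cancel₀ hY0, mul_one]
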